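/- Let $A$ be an exact C*-algebra (not necessarily unital), i.e. $A$ has a faithful *-representation on a Hilbert space that is a point-norm limit of maps $\psi\circ\varphi$ with $\varphi\colon A\to B$, $\psi\colon B\to\mathcal B(\mathcal H)$ contractive completely positive and $B$ a finite-dimensional C*-algebra. Let $\alpha$ be a *-automorphism of $A$. The mapping torus of $\alpha$ is the C*-algebra \[ M_\alpha=\{f\colon[0,1]\to A \text{ continuous} : f(1)=\alpha(f(0))\}, \] and for $t\in\mathbb R$ the automorphism $\phi_t$ of $M_\alpha$ is given by \[ (\phi_t f)(s)=\alpha^n(f(s+t-n)),\qquad s\in[0,1],\ n\in\mathbb Z,\ n\le s+t<n+1 . \] For a C*-algebra $D$, a faithful *-representation $\pi\colon D\to\mathcal B(\mathcal H)$, a set $\omega\subset D$ and $\delta>0$, let $\mathrm{rcp}(\omega,\delta)\in\{1,2,\dots\}\cup\{\infty\}$ be the infimum of $\mathrm{rank}(B)$ over all triples $(\varphi,\psi,B)$ where $B$ is a nonzero finite-dimensional C*-algebra, $\varphi\colon D\to B$ and $\psi\colon B\to\mathcal B(\mathcal H)$ are contractive completely positive maps, and $\|\psi(\varphi(x))-\pi(x)\|<\delta$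 for all $x\in\omega$; here $\mathrm{rank}(B)$ is the dimension of a maximal abelian *-subalgebra of $B$. The Voiculescu–Brown entropy of an automorphism $\beta$ of $D$, computed in $\pi$, is \[ \mathrm{ht}(\beta)=\sup_{\omega\subset D\text{ finite}}\ \sup_{\delta>0}\ \limsup_{m\to\infty}\frac1m\log \mathrm{rcp}\bigl(\omega\cup\beta(\omega)\cup\dots\cup\beta^{m-1}(\omega),\delta\bigr)\in[0,\infty]. \] Then $M_\alpha$ is exact, and for every $t\in\mathbb R$ \[ \mathrm{ht}(\phi_t)=|t|\,\mathrm{ht}(\alpha), \] whichever faithful *-representations of $A$ and of $M_\alpha$ are used to compute the two entropies, and with the convention $0\cdot\infty=0$. -/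

import Mathlib

open Filter Topology

universe u

noncomputable section

namespace VoiculescuBrown

/-! ### Completely positive approximations and the Voiculescu-Brown entropy -/

/-- The rank of a C⋆-algebra `B` (used for finite dimensional `B`): the dimension of a maximal
abelian ⋆-subalgebra. (For finite dimensional `B` all maximal abelian ⋆-subalgebras have the same
dimension, so the set below is a singleton.) -/
def rank (B : Type*) [CStarAlgebra B] : ℕ :=
  sSup {r : ℕ | ∃ D : StarSubalgebra ℂ B,
    Maximal (fun E : StarSubalgebra ℂ B => ∀ x ∈ E, ∀ y ∈ E, x * y = y * x) D ∧
      Module.finrank ℂ D = r}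

/-- The collection `CPA(A, H)` of all triples `(φ, ψ, B)`, where `B` is a (nonzero) finite
dimensional C⋆-algebra and `φ : A → B`, `ψ : B → B(H)` are contractive completely positive maps.
Every finite dimensional C⋆-algebra is isomorphic to one whose carrier is in `Type`. The order
on `B` is the usual one: it is determined by `StarOrderedRing`. -/
structure CPA (A : Type*) [NonUnitalCStarAlgebra A] [PartialOrder A] [StarOrderedRing A]
    (H : Type*) [NormedAddCommGroup H] [InnerProductSpace ℂ H] [CompleteSpace H] where
  B : Type
  [instCStarAlgebra : CStarAlgebra B]
  [instPartialOrder : PartialOrder B]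
  [instStarOrderedRing : StarOrderedRing B]
  [instNontrivial : Nontrivial B]
  [instFiniteDimensional : FiniteDimensional ℂ B]
  φ : CompletelyPositiveMap A B
  ψ : CompletelyPositiveMap B (H →L[ℂ] H)
  norm_φ_le : ∀ a : A, ‖φ a‖ ≤ ‖a‖
  norm_ψ_le : ∀ b : B, ‖ψ b‖ ≤ ‖b‖

attribute [instance] CPA.instCStarAlgebra CPA.instPartialOrder CPA.instStarOrderedRing
  CPA.instNontrivial CPA.instFiniteDimensional

section Entropy

variable {A : Type*} [NonUnitalCStarAlgebra A] [PartialOrder A] [StarOrderedRing A]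
  {H : Type*} [NormedAddCommGroup H] [InnerProductSpace ℂ H] [CompleteSpace H]

/-- The triple `(φ, ψ, B)` satisfies `‖ψ (φ x) - π x‖ < δ` for all `x ∈ ω`. -/
def CPA.Approximates (T : CPA A H) (π : A →⋆ₙₐ[ℂ] (H →L[ℂ] H)) (ω : Set A) (δ : ℝ) : Prop :=
  ∀ x ∈ ω, ‖T.ψ (T.φ x) - π x‖ < δ

/-- `rcp(ω, δ)`, computed in the representation `π`: the infimum of the ranks of all completely
positive approximations of `π` on `ω` within `δ` (`⊤` if there is none). -/
def rcp (π : A →⋆ₙₐ[ℂ] (H →L[ℂ] H)) (ω : Set A) (δ : ℝ) : ℕ∞ :=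
  ⨅ (T : CPA A H) (_ : T.Approximates π ω δ), (rank T.B : ℕ∞)

/-- `ht(α, ω, δ)`: the upper limit, as `m → ∞`, of
`(1 / m) * log (rcp (ω ∪ α(ω) ∪ ⋯ ∪ α ^ (m - 1) (ω), δ))`. -/
def htAt (π : A →⋆ₙₐ[ℂ] (H →L[ℂ] H)) (α : A ≃⋆ₐ[ℂ] A) (ω : Set A) (δ : ℝ) : EReal :=
  limsup (fun m : ℕ =>
    ENNReal.log (rcp π (⋃ i ∈ Set.Iio m, (α ^ i : A ≃⋆ₐ[ℂ] A) '' ω) δ : ENNReal) / (m : EReal))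
    atTop

/-- The Voiculescu-Brown entropy `ht(α)` of the automorphism `α`, computed in the
representation `π`: the supremum of `ht(α, ω, δ)` over all finite sets `ω` and all `δ > 0`. -/
def ht (π : A →⋆ₙₐ[ℂ] (H →L[ℂ] H)) (α : A ≃⋆ₐ[ℂ] A) : EReal :=
  ⨆ ω : Finset A, ⨆ (δ : ℝ) (_ : 0 < δ), htAt π α (ω : Set A) δ

end Entropy

/-- A C⋆-algebra is exact if it has a faithful ⋆-representation on a Hilbert space which is
nuclear, that is, a point-norm limit of contractive completely positive maps that factor,
by contractive completely positive maps, through finite dimensional C⋆-algebras. -/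
def IsExact (A : Type u) [NonUnitalCStarAlgebra A] [PartialOrder A] [StarOrderedRing A] : Prop :=
  ∃ (H : Type u) (_ : NormedAddCommGroup H) (_ : InnerProductSpace ℂ H) (_ : CompleteSpace H)
    (π : A →⋆ₙₐ[ℂ] (H →L[ℂ] H)), Function.Injective π ∧
      ∀ (ω : Finset A) (δ : ℝ), 0 < δ → ∃ T : CPA A H, T.Approximates π (ω : Set A) δ

/-! ### The mapping torus and its flow -/

section MappingTorus

variable {A : Type*} [NonUnitalCStarAlgebra A]

/-- The mapping torus of `α` as a ⋆-subalgebra of `C([0,1], A)`: all `f` with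
`f(1) = α(f(0))`. -/
def mappingTorus (α : A ≃⋆ₐ[ℂ] A) : NonUnitalStarSubalgebra ℂ C(unitInterval, A) where
  carrier := {f | f 1 = α (f 0)}
  zero_mem' := by simp
  add_mem' {f g} hf hg := by
    simp only [Set.mem_ofPred_eq] at hf hg ⊢
    simp [hf, hg]
  mul_mem' {f g} hf hg := by
    simp only [Set.mem_ofPred_eq] at hf hg ⊢
    simp [hf, hg]
  smul_mem' c f hf := by
    simp only [Set.mem_ofPred_eq] at hf ⊢
    simp [hf]
  star_mem' {f} hf := by
    simp only [Set.mem_ofPred_eq] at hf ⊢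
    simp [hf, map_star]

theorem mem_mappingTorus {α : A ≃⋆ₐ[ℂ] A} {f : C(unitInterval, A)} :
    f ∈ mappingTorus α ↔ f 1 = α (f 0) := Iff.rfl

theorem continuous_starAlgEquiv (α : A ≃⋆ₐ[ℂ] A) : Continuous α :=
  (StarAlgEquiv.isometry α).continuous

instance isClosed_mappingTorus (α : A ≃⋆ₐ[ℂ] A) :
    IsClosed (mappingTorus α : Set C(unitInterval, A)) :=
  isClosed_eq (continuous_eval_const _)
    ((continuous_starAlgEquiv α).comp (continuous_eval_const _))

/-- The mapping torus of `α`. It carries the C⋆-algebra structure of a closed ⋆-subalgebra of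
`C([0,1], A)` (pointwise operations, supremum norm) and the usual order of a C⋆-algebra. -/
def MappingTorus (α : A ≃⋆ₐ[ℂ] A) : Type _ := mappingTorus α

namespace MappingTorus

variable {α : A ≃⋆ₐ[ℂ] A}

instance instNonUnitalCStarAlgebra : NonUnitalCStarAlgebra (MappingTorus α) :=
  inferInstanceAs (NonUnitalCStarAlgebra (mappingTorus α))

instance instPartialOrder : PartialOrder (MappingTorus α) :=
  CStarAlgebra.spectralOrder (MappingTorus α)

instance instStarOrderedRing : StarOrderedRing (MappingTorus α) :=
  CStarAlgebra.spectralOrderedRing (MappingTorus α)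

/-- The function `[0,1] → A` underlying an element of the mapping torus. -/
def toMap (f : MappingTorus α) : C(unitInterval, A) := f.1

theorem toMap_one (f : MappingTorus α) : f.toMap 1 = α (f.toMap 0) := f.2

/-- The function `x ↦ α ^ n (f (x - n))`, where `n` is the integer with `n ≤ x < n + 1`. -/
def extend (f : MappingTorus α) (x : ℝ) : A :=
  (α ^ ⌊x⌋ : A ≃⋆ₐ[ℂ] A) (f.toMap ⟨Int.fract x, unitInterval.fract_mem x⟩)

theorem extend_of_mem (f : MappingTorus α) (n : ℤ) {x : ℝ} (h : x - n ∈ unitInterval) :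
    f.extend x = (α ^ n : A ≃⋆ₐ[ℂ] A) (f.toMap ⟨x - n, h⟩) := by
  rcases h.2.lt_or_eq with h1 | h1
  · have hn : ⌊x⌋ = n := by
      rw [Int.floor_eq_iff]
      constructor <;> linarith [h.1]
    simp only [extend, Int.fract, hn]
  · have hx : x = ((n + 1 : ℤ) : ℝ) := by push_cast; linarith
    subst hx
    have e0 : (⟨Int.fract ((n + 1 : ℤ) : ℝ), unitInterval.fract_mem _⟩ : unitInterval) = 0 := by
      ext; simp
    have e1 : (⟨((n + 1 : ℤ) : ℝ) - n, h⟩ : unitInterval) = 1 := by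
      ext; simp
    rw [extend, e0, e1, toMap_one, Int.floor_intCast, zpow_add_one, StarAlgEquiv.mul_apply]

theorem continuous_extend (f : MappingTorus α) : Continuous f.extend := by
  have hlf : LocallyFinite (fun n : ℤ => Set.Icc (n : ℝ) (n + 1)) :=
    locallyFinite_Icc_of_tendsto tendsto_intCast_atTop_atTop
      (tendsto_atBot_add_const_right _ _ (tendsto_intCast_atBot_iff.2 tendsto_id))
  refine hlf.continuous ?_ (fun n => isClosed_Icc) ?_
  · rw [Set.eq_univ_iff_forall]
    intro x
    exact Set.mem_iUnion.2 ⟨⌊x⌋, Int.floor_le x, (Int.lt_floor_add_one x).le⟩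
  · intro n
    rw [continuousOn_iff_continuous_domRestrict]
    have hmem : ∀ x : Set.Icc (n : ℝ) (n + 1), (x : ℝ) - n ∈ unitInterval := fun x =>
      ⟨by linarith [x.2.1], by linarith [x.2.2]⟩
    have : (Set.Icc (n : ℝ) (n + 1)).domRestrict f.extend =
        fun x : Set.Icc (n : ℝ) (n + 1) => (α ^ n : A ≃⋆ₐ[ℂ] A) (f.toMap ⟨(x : ℝ) - n, hmem x⟩) := by
      funext x
      exact f.extend_of_mem n (hmem x)
    rw [this]
    exact (continuous_starAlgEquiv _).comp (f.toMap.continuous.comp (by fun_prop))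

theorem extend_add_one (f : MappingTorus α) (x : ℝ) : f.extend (x + 1) = α (f.extend x) := by
  have e : (⟨Int.fract (x + 1), unitInterval.fract_mem _⟩ : unitInterval) =
      ⟨Int.fract x, unitInterval.fract_mem _⟩ := by
    ext; simp
  rw [extend, extend, e, Int.floor_add_one, add_comm, zpow_one_add, StarAlgEquiv.mul_apply]

theorem extend_add_int (f : MappingTorus α) (x : ℝ) (n : ℤ) :
    f.extend (x + n) = (α ^ n : A ≃⋆ₐ[ℂ] A) (f.extend x) := by
  have e : (⟨Int.fract (x + n), unitInterval.fract_mem _⟩ : unitInterval) =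
      ⟨Int.fract x, unitInterval.fract_mem _⟩ := by
    ext; simp
  rw [extend, extend, e, Int.floor_add_intCast, add_comm, zpow_add, StarAlgEquiv.mul_apply]

theorem extend_coe (f : MappingTorus α) (s : unitInterval) : f.extend s = f.toMap s := by
  have h : (s : ℝ) - (0 : ℤ) ∈ unitInterval := by simp
  rw [f.extend_of_mem 0 h]
  simp

/-- Translation by `t`: `(φ_t f)(s) = α ^ n (f (s + t - n))`, where `n` is the integer with
`n ≤ s + t < n + 1`. -/
def shift (t : ℝ) (f : MappingTorus α) : MappingTorus α :=
  ⟨⟨fun s => f.extend (s + t), f.continuous_extend.comp (by fun_prop)⟩, by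
    rw [mem_mappingTorus]
    simp only [ContinuousMap.coe_mk, Set.Icc.coe_one, Set.Icc.coe_zero]
    rw [← extend_add_one, add_comm (1 : ℝ), zero_add]⟩

theorem shift_apply (t : ℝ) (f : MappingTorus α) (s : unitInterval) :
    (shift t f).toMap s = (α ^ ⌊(s : ℝ) + t⌋ : A ≃⋆ₐ[ℂ] A)
      (f.toMap ⟨Int.fract ((s : ℝ) + t), unitInterval.fract_mem _⟩) := rfl

theorem extend_shift (t : ℝ) (f : MappingTorus α) (x : ℝ) :
    (shift t f).extend x = f.extend (x + t) := by
  have h : (shift t f).extend x = (α ^ ⌊x⌋ : A ≃⋆ₐ[ℂ] A) (f.extend (Int.fract x + t)) := rfl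
  rw [h, ← extend_add_int]
  congr 1
  linarith [Int.fract_add_floor x]

theorem toMap_injective : Function.Injective (toMap : MappingTorus α → C(unitInterval, A)) :=
  Subtype.val_injective

theorem shift_shift (t u : ℝ) (f : MappingTorus α) :
    shift t (shift u f) = shift (t + u) f := by
  apply toMap_injective
  ext s
  change (shift u f).extend (s + t) = f.extend (s + (t + u))
  rw [extend_shift, add_assoc]

theorem shift_zero (f : MappingTorus α) : shift 0 f = f := by
  apply toMap_injective
  ext s
  change f.extend (s + 0) = _
  rw [add_zero, extend_coe]

end MappingTorus

open MappingTorus in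
/-- The mapping torus flow: `flow α t` is the time-`t` automorphism `φ_t` of the mapping torus
of `α`. -/
def flow (α : A ≃⋆ₐ[ℂ] A) (t : ℝ) : MappingTorus α ≃⋆ₐ[ℂ] MappingTorus α where
  toFun := shift t
  invFun := shift (-t)
  left_inv f := by rw [shift_shift, neg_add_cancel, shift_zero]
  right_inv f := by rw [shift_shift, add_neg_cancel, shift_zero]
  map_mul' f g := toMap_injective <| ContinuousMap.ext fun _ => map_mul (α ^ _ : A ≃⋆ₐ[ℂ] A) _ _
  map_add' f g := toMap_injective <| ContinuousMap.ext fun _ => map_add (α ^ _ : A ≃⋆ₐ[ℂ] A) _ _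
  map_star' f := toMap_injective <| ContinuousMap.ext fun _ => map_star (α ^ _ : A ≃⋆ₐ[ℂ] A) _
  map_smul' c f := toMap_injective <| ContinuousMap.ext fun _ =>
    map_smul (α ^ _ : A ≃⋆ₐ[ℂ] A) c _

end MappingTorus

end VoiculescuBrown

end

/-!
The statement rests on three facts.

*Independence of the representation* (`rcp_eq_rcp`). If `ψ ∘ φ` approximates a faithful
representation `π` on a finite set, then for any other representation `ρ` there is `ψ'` such that
`ψ' ∘ φ` approximates `ρ` there (`exists_transfer`). This is the special case of Arveson's extension
theorem that is needed, and it is proved directly: by a Hahn-Banach argument the compressions of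
`ρ` to finitely many vectors are limits of finite sums of compressions of `π`
(`exists_vectors`), because an injective ⋆-homomorphism reflects positivity of matrices. An
approximate unit makes the compressing operators contractive, and a weak operator limit over all
finite dimensional subspaces gives `ψ'`. As a consequence an automorphism and its inverse have the
same entropy (`ht_inv`), and it is enough to consider times `t ≥ 0` and the representation
`fibreRep` of the mapping torus on `ℓ²([0,1], H)`, the direct sum of all point evaluations.

*Upper bound* (`rcp_flow_le`). The translates `φ_{it}(f)` of finitely many elements are
equicontinuous, so the same finite set of sample points in `[0,1]` and the same partition of unity
serve all of them. The values of `φ_{it}(f)`, `i < m`, are `α ^ k (f(r))` with `k < m t + 2`, so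
that an approximation of `A` on about `m t` iterates of a finite set gives an approximation of the
mapping torus whose rank is larger by a constant factor only (`CPA.sample`). The same construction shows
that the mapping torus is exact.

*Lower bound* (`exists_rcp_le_flow`). Given an approximation `ψ ∘ φ` of the mapping torus, let `z`
be a tent function on `[0,1]` with peak `1` at the midpoint, precompose `φ` with `a ↦ z a` and compress
`ψ` to the fibre over the midpoint (`CPA.localize`). The element `z α ^ k (a)` need not lie in the
finite set on which `ψ ∘ φ` is good, but for `a ≥ 0` it lies between two elements that do: the
images under the flow of slightly lower and slightly higher tents, whose values over the midpoint are
close to `α ^ k (a)`. Positivity of `ψ ∘ φ` gives the estimate, also for non-unital `A`.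

Both bounds compare growth rates under a change of time `m ↦ m t` (`limsup_div_le`).
-/

open Filter Topology

noncomputable section

namespace VoiculescuBrown

open scoped ComplexOrder CStarAlgebra

/-! ### Matrix positivity and completely positive maps -/

section Order

variable {A B : Type*} [NonUnitalCStarAlgebra A] [PartialOrder A] [StarOrderedRing A]
  [NonUnitalCStarAlgebra B] [PartialOrder B] [StarOrderedRing B]

omit [NonUnitalCStarAlgebra B] [PartialOrder B] [StarOrderedRing B] in
/-- Stated for an abstract C⋆-algebra so that it applies to `CStarMatrix`, where the real module
structure of the functional calculus is not found by instance search. -/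
theorem exists_eq_star_mul_self {a : A} (h : 0 ≤ a) : ∃ b, a = star b * b :=
  CStarAlgebra.nonneg_iff_eq_star_mul_self.1 h

theorem map_nonneg_of_nonneg (φ : A →⋆ₙₐ[ℂ] B) {a : A} (h : 0 ≤ a) : 0 ≤ φ a := by
  obtain ⟨b, rfl⟩ := exists_eq_star_mul_self h
  rw [map_mul, map_star]
  exact star_mul_self_nonneg _

/-- An injective ⋆-homomorphism reflects positivity, since it maps the negative part of a
self-adjoint element to the negative part of its image. -/
theorem nonneg_of_map_nonneg (φ : A →⋆ₙₐ[ℂ] B) (hφ : Function.Injective φ) {a : A}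
    (h : 0 ≤ φ a) : 0 ≤ a := by
  have ha : IsSelfAdjoint a := hφ (by rw [map_star, (IsSelfAdjoint.of_nonneg h).star_eq])
  rw [← CFC.negPart_eq_zero_iff a ha]
  apply hφ
  have hc : Continuous φ := (NonUnitalStarAlgHom.isometry φ hφ).continuous
  have hsa : IsSelfAdjoint (φ a) := IsSelfAdjoint.of_nonneg h
  rw [map_zero, CFC.negPart_def,
    NonUnitalStarAlgHomClass.map_cfcₙ (S := ℂ) φ _ a (by fun_prop) (by simp) hc ha hsa,
    ← CFC.negPart_def, CFC.negPart_eq_zero_iff _ hsa]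
  exact h

end Order

section MatrixOperator

variable {n : Type*} [Fintype n] {H : Type*} [NormedAddCommGroup H] [InnerProductSpace ℂ H]

/-- The operator on the Hilbert space `Hⁿ` given by a matrix of operators on `H`. -/
def matrixOp (M : CStarMatrix n n (H →L[ℂ] H)) :
    PiLp 2 (fun _ : n => H) →L[ℂ] PiLp 2 (fun _ : n => H) :=
  ((PiLp.continuousLinearEquiv 2 ℂ (fun _ : n => H)).symm : (n → H) →L[ℂ] PiLp 2 (fun _ => H)) ∘L
    (ContinuousLinearMap.pi fun i => ∑ j, M i j ∘L ContinuousLinearMap.proj j) ∘L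
      ((PiLp.continuousLinearEquiv 2 ℂ (fun _ : n => H)) : PiLp 2 (fun _ => H) →L[ℂ] (n → H))

theorem matrixOp_apply (M : CStarMatrix n n (H →L[ℂ] H)) (v : PiLp 2 (fun _ : n => H)) (i : n) :
    matrixOp M v i = ∑ j, M i j (v j) := by
  simp [matrixOp]

theorem inner_matrixOp (M : CStarMatrix n n (H →L[ℂ] H)) (v w : PiLp 2 (fun _ : n => H)) :
    inner ℂ v (matrixOp M w) = ∑ i, ∑ j, inner ℂ (v i) (M i j (w j)) := by
  simp [PiLp.inner_apply, matrixOp_apply, inner_sum]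

variable [CompleteSpace H]

variable (n H) in
/-- The ⋆-homomorphism `Mₙ(B(H)) → B(Hⁿ)`. -/
def matrixOpHom : CStarMatrix n n (H →L[ℂ] H) →⋆ₙₐ[ℂ]
    (PiLp 2 (fun _ : n => H) →L[ℂ] PiLp 2 (fun _ : n => H)) where
  toFun := matrixOp
  map_smul' c M := by
    ext v i
    simp [matrixOp_apply, Finset.smul_sum]
  map_zero' := by
    ext v i
    simp [matrixOp_apply]
  map_add' M N := by
    ext v i
    simp [matrixOp_apply, Finset.sum_add_distrib]
  map_mul' M N := by
    ext v i
    simp only [matrixOp_apply, mul_apply_eq_comp, CStarMatrix.mul_apply,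
      _root_.sum_apply, map_sum]
    exact Finset.sum_comm
  map_star' M := by
    rw [ContinuousLinearMap.star_eq_adjoint, ContinuousLinearMap.eq_adjoint_iff]
    intro v w
    rw [inner_matrixOp, ← inner_conj_symm, inner_matrixOp]
    simp only [map_sum, inner_conj_symm, CStarMatrix.star_apply]
    rw [Finset.sum_comm]
    refine Finset.sum_congr rfl fun i _ => Finset.sum_congr rfl fun j _ => ?_
    rw [ContinuousLinearMap.star_eq_adjoint, ContinuousLinearMap.adjoint_inner_left]

theorem matrixOpHom_injective : Function.Injective (matrixOpHom n H) := by
  classical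
  intro M N h
  ext i j v
  have := congrArg (fun T => T (WithLp.toLp 2 (Pi.single j v)) i) h
  simp only [matrixOpHom, NonUnitalStarAlgHom.coe_mk', NonUnitalAlgHom.coe_mk] at this
  change matrixOp M _ i = matrixOp N _ i at this
  rw [matrixOp_apply, matrixOp_apply, Finset.sum_eq_single j, Finset.sum_eq_single j] at this
  · simpa using this
  all_goals simp +contextual

omit [CompleteSpace H] in
/-- An operator on a complex Hilbert space is positive when its quadratic form is nonnegative. -/
theorem operator_nonneg_iff (T : H →L[ℂ] H) : 0 ≤ T ↔ ∀ v, 0 ≤ inner ℂ v (T v) := by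
  rw [ContinuousLinearMap.nonneg_iff_isPositive]
  refine ⟨fun h v => h.inner_nonneg_right v, fun h => ?_⟩
  rw [ContinuousLinearMap.isPositive_iff_complex]
  intro v
  have hv := h v
  rw [← inner_conj_symm, RCLike.nonneg_iff] at hv
  obtain ⟨h1, h2⟩ := hv
  simp only [RCLike.conj_re, RCLike.conj_im, neg_eq_zero] at h1 h2
  refine ⟨?_, h1⟩
  exact RCLike.ext (by simp) (by simpa using h2.symm)

theorem matrix_nonneg_iff (M : CStarMatrix n n (H →L[ℂ] H)) :
    0 ≤ M ↔ ∀ v : n → H, 0 ≤ ∑ i, ∑ j, inner ℂ (v i) (M i j (v j)) := by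
  have key : 0 ≤ M ↔ 0 ≤ matrixOpHom n H M :=
    ⟨map_nonneg_of_nonneg (matrixOpHom n H),
      nonneg_of_map_nonneg (matrixOpHom n H) matrixOpHom_injective⟩
  rw [key, operator_nonneg_iff]
  refine ⟨fun h v => ?_, fun h v => ?_⟩
  · have := h (WithLp.toLp 2 v)
    change 0 ≤ inner ℂ _ (matrixOp M _) at this
    rwa [inner_matrixOp] at this
  · change 0 ≤ inner ℂ _ (matrixOp M _)
    rw [inner_matrixOp]
    exact h _

end MatrixOperator

section CompletelyPositive

variable {A B C : Type*} [NonUnitalCStarAlgebra A] [PartialOrder A] [StarOrderedRing A]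
  [NonUnitalCStarAlgebra B] [PartialOrder B] [StarOrderedRing B]
  [NonUnitalCStarAlgebra C] [PartialOrder C] [StarOrderedRing C]
  {K : Type*} [NormedAddCommGroup K] [InnerProductSpace ℂ K] [CompleteSpace K]

/-- A linear map into `B(K)` whose associated kernel is positive semidefinite is completely
positive: a positive matrix has the form `N⋆ N`, so it is a sum of matrices
`(xᵢ⋆ xⱼ)`. -/
def cpOfKernel (θ : A →ₗ[ℂ] (K →L[ℂ] K))
    (h : ∀ (n : ℕ) (x : Fin n → A) (ξ : Fin n → K),
      0 ≤ ∑ i, ∑ j, inner ℂ (ξ i) (θ (star (x i) * x j) (ξ j))) :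
    A →CP (K →L[ℂ] K) where
  toLinearMap := θ
  map_cstarMatrix_nonneg' n M hM := by
    obtain ⟨N, rfl⟩ := exists_eq_star_mul_self hM
    rw [matrix_nonneg_iff]
    intro v
    have : ∑ i, ∑ j, inner ℂ (v i) (((star N * N).map θ) i j (v j)) =
        ∑ k, ∑ i, ∑ j, inner ℂ (v i) (θ (star (N k i) * N k j) (v j)) := by
      simp only [CStarMatrix.map_apply, CStarMatrix.mul_apply, map_sum,
        _root_.sum_apply, inner_sum, CStarMatrix.star_apply]
      rw [Finset.sum_comm (s := Finset.univ (α := Fin n)) (t := Finset.univ (α := Fin n))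
        (f := fun k i => ∑ j, inner ℂ (v i) (θ (star (N k i) * N k j) (v j)))]
      exact Finset.sum_congr rfl fun i _ => Finset.sum_comm
    rw [this]
    exact Finset.sum_nonneg fun k _ => h n _ v

@[simp]
theorem cpOfKernel_apply (θ : A →ₗ[ℂ] (K →L[ℂ] K)) (h) (a : A) : cpOfKernel θ h a = θ a := rfl

theorem cp_kernel_nonneg (φ : A →CP (K →L[ℂ] K)) {n : Type*} [Fintype n] (x : n → A)
    (ξ : n → K) : 0 ≤ ∑ i, ∑ j, inner ℂ (ξ i) (φ (star (x i) * x j) (ξ j)) := by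
  classical
  rcases isEmpty_or_nonempty n with hn | ⟨⟨k⟩⟩
  · simp
  -- The matrix `(xᵢ⋆ xⱼ)` is `N⋆ N` for the matrix `N` with the single nonzero row `x`.
  let N : CStarMatrix n n A := fun i j => if i = k then x j else 0
  have hN : star N * N = fun i j => star (x i) * x j := by
    ext i j
    rw [CStarMatrix.mul_apply, Finset.sum_eq_single k]
    · rw [CStarMatrix.star_apply]
      simp [N]
    · intro b _ hb
      simp [N, hb]
    · simp
  have h := φ.map_cstarMatrix_nonneg (star N * N) (star_mul_self_nonneg N)
  rw [hN, matrix_nonneg_iff] at h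
  exact h ξ

/-- A linear map `θ` is completely positive when `θ (x⋆ y) = τ(x)⋆ τ(y)` for some map `τ`. -/
def cpOfFactor (θ : A →ₗ[ℂ] B) (τ : A → B) (h : ∀ x y, θ (star x * y) = star (τ x) * τ y) :
    A →CP B where
  toLinearMap := θ
  map_cstarMatrix_nonneg' n M hM := by
    obtain ⟨N, rfl⟩ := exists_eq_star_mul_self hM
    have : (star N * N).map θ = star (N.map τ) * N.map τ := by
      ext i j
      simp [CStarMatrix.mul_apply, CStarMatrix.star_apply, h]
    rw [this]
    exact star_mul_self_nonneg _

/-- The composition of two completely positive maps. -/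
def cpComp (ψ : B →CP C) (φ : A →CP B) : A →CP C where
  toLinearMap := ψ.toLinearMap ∘ₗ φ.toLinearMap
  map_cstarMatrix_nonneg' n M hM :=
    ψ.map_cstarMatrix_nonneg' n _ (φ.map_cstarMatrix_nonneg' n M hM)

/-- A ⋆-homomorphism, as a completely positive map. -/
def cpOfHom (φ : A →⋆ₙₐ[ℂ] B) : A →CP B :=
  cpOfFactor (φ : A →ₗ[ℂ] B) φ (by simp [map_star])

/-- Finitely many completely positive maps, combined into one map to the product. -/
def cpPi {ι : Type*} [Fintype ι] {D : ι → Type*} [∀ i, NonUnitalCStarAlgebra (D i)]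
    [∀ i, PartialOrder (D i)] [∀ i, StarOrderedRing (D i)] (φ : ∀ i, A →CP D i) :
    A →CP (∀ i, D i) where
  toLinearMap := LinearMap.pi fun i => (φ i).toLinearMap
  map_cstarMatrix_nonneg' n M hM := by
    -- Factor each coordinate of the image as `N⋆ N` and assemble the factors.
    choose N hN using fun i => exists_eq_star_mul_self
      ((φ i).map_cstarMatrix_nonneg' n M hM)
    let N' : CStarMatrix (Fin n) (Fin n) (∀ i, D i) := fun k l i => N i k l
    have : M.map (LinearMap.pi fun i => (φ i).toLinearMap) = star N' * N' := by
      ext k l i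
      have := congrArg (fun Q => Q k l) (hN i)
      simp only [CStarMatrix.map_apply, CStarMatrix.mul_apply, CStarMatrix.star_apply] at this ⊢
      simpa [N'] using this
    rw [this]
    exact star_mul_self_nonneg _

end CompletelyPositive

/-! ### Approximating one representation by compressions of another -/

section Separation

variable {D : Type*} [NonUnitalCStarAlgebra D] [PartialOrder D] [StarOrderedRing D]
  {H : Type*} [NormedAddCommGroup H] [InnerProductSpace ℂ H] [CompleteSpace H]
  {K : Type*} [NormedAddCommGroup K] [InnerProductSpace ℂ K] [CompleteSpace K]
  {n : Type*} [Fintype n]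

omit [PartialOrder D] [StarOrderedRing D] in
theorem sum_inner_add_star (σ : D →⋆ₙₐ[ℂ] (K →L[ℂ] K)) (X : CStarMatrix n n D) (v : n → K) :
    ∑ i, ∑ j, inner ℂ (v i) (σ ((X + star X) i j) (v j)) =
      ((2 * (∑ i, ∑ j, inner ℂ (v i) (σ (X i j) (v j))).re : ℝ) : ℂ) := by
  have h : ∑ i, ∑ j, inner ℂ (v i) (σ (star X i j) (v j)) =
      (starRingEnd ℂ) (∑ i, ∑ j, inner ℂ (v i) (σ (X i j) (v j))) := by
    simp only [map_sum]
    rw [Finset.sum_comm]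
    refine Finset.sum_congr rfl fun i _ => Finset.sum_congr rfl fun j _ => ?_
    rw [CStarMatrix.star_apply, map_star, ContinuousLinearMap.star_eq_adjoint,
      ContinuousLinearMap.adjoint_inner_right, inner_conj_symm]
  simp only [CStarMatrix.add_apply, map_add, add_apply, inner_add_right,
    Finset.sum_add_distrib, h]
  rw [Complex.add_conj]

/-- If a matrix over `D` has a quadratic form with nonnegative real part in a faithful
representation, then it has one in every representation. -/
theorem re_form_nonneg (π : D →⋆ₙₐ[ℂ] (H →L[ℂ] H)) (hπ : Function.Injective π)
    (ρ : D →⋆ₙₐ[ℂ] (K →L[ℂ] K)) (X : CStarMatrix n n D)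
    (h : ∀ v : n → H, 0 ≤ (∑ i, ∑ j, inner ℂ (v i) (π (X i j) (v j))).re) (w : n → K) :
    0 ≤ (∑ i, ∑ j, inner ℂ (w i) (ρ (X i j) (w j))).re := by
  have h1 : 0 ≤ CStarMatrix.mapₙₐ π (X + star X) := by
    rw [matrix_nonneg_iff]
    intro v
    change 0 ≤ ∑ i, ∑ j, inner ℂ (v i) (π ((X + star X) i j) (v j))
    rw [sum_inner_add_star, Complex.zero_le_real]
    exact mul_nonneg zero_le_two (h v)
  have h2 : 0 ≤ X + star X :=
    nonneg_of_map_nonneg (CStarMatrix.mapₙₐ π) (CStarMatrix.map_injective hπ) h1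
  have h3 := map_nonneg_of_nonneg (CStarMatrix.mapₙₐ ρ) h2
  rw [matrix_nonneg_iff] at h3
  have h4 : 0 ≤ ∑ i, ∑ j, inner ℂ (w i) (ρ ((X + star X) i j) (w j)) := h3 w
  rw [sum_inner_add_star, Complex.zero_le_real] at h4
  linarith

/-- The compressions of a representation `π` to a tuple of vectors, on finitely many elements. -/
def compression (π : D →⋆ₙₐ[ℂ] (H →L[ℂ] H)) (ω : Finset D) (v : n → H) : ω × n × n → ℂ :=
  fun p => inner ℂ (v p.2.1) (π p.1 (v p.2.2))

/-- The convex cone generated by the compressions of `π`. -/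
def compressionCone (π : D →⋆ₙₐ[ℂ] (H →L[ℂ] H)) (ω : Finset D) (n : Type*) [Fintype n] :
    PointedCone ℝ (ω × n × n → ℂ) where
  carrier := {u | ∃ l : List (n → H), u = (l.map (compression π ω)).sum}
  zero_mem' := ⟨[], rfl⟩
  add_mem' := by
    rintro _ _ ⟨l, rfl⟩ ⟨l', rfl⟩
    exact ⟨l ++ l', by rw [List.map_append, List.sum_append]⟩
  smul_mem' := by
    rintro ⟨c, hc⟩ _ ⟨l, rfl⟩
    refine ⟨l.map fun v => ((√c : ℝ) : ℂ) • v, ?_⟩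
    rw [List.smul_sum, List.map_map, List.map_map]
    congr 1
    refine List.map_congr_left fun v _ => ?_
    ext p
    have : (c : ℂ) = (√c : ℝ) * (√c : ℝ) := by
      rw [← Complex.ofReal_mul, Real.mul_self_sqrt hc]
    simp only [Function.comp_apply, compression, Pi.smul_apply, map_smul, inner_smul_left,
      inner_smul_right, Complex.conj_ofReal, ← mul_assoc, ← this]
    rfl

/-- A real linear functional on `ℂ ^ P` is the real part of a complex linear combination of
the coordinates. -/
theorem real_functional_eq {P : Type*} [Fintype P] [DecidableEq P] (f : StrongDual ℝ (P → ℂ)) :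
    ∃ y : P → ℂ, ∀ u, f u = (∑ p, y p * u p).re := by
  refine ⟨fun p => ⟨f (Pi.single p 1), -f (Pi.single p Complex.I)⟩, fun u => ?_⟩
  have hu : u = ∑ p, ((u p).re • (Pi.single p 1 : P → ℂ) +
      (u p).im • (Pi.single p Complex.I : P → ℂ)) := by
    ext q
    rw [Finset.sum_apply, Finset.sum_eq_single q]
    · simp [Complex.re_add_im]
    · intro p _ hp
      simp [Pi.single_eq_of_ne hp.symm]
    · simp
  conv_lhs => rw [hu]
  rw [map_sum, Complex.re_sum]
  refine Finset.sum_congr rfl fun p _ => ?_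
  rw [map_add, map_smul, map_smul, Complex.mul_re]
  simp only [smul_eq_mul]
  ring

omit [PartialOrder D] [StarOrderedRing D] in
theorem sum_inner_eq_sum_compression (σ : D →⋆ₙₐ[ℂ] (K →L[ℂ] K)) (ω : Finset D)
    (y : ω × n × n → ℂ) (v : n → K) :
    ∑ i, ∑ j, inner ℂ (v i) (σ (∑ x : ω, y (x, i, j) • (x : D)) (v j)) =
      ∑ p, y p * compression σ ω v p := by
  simp only [map_sum, _root_.sum_apply, inner_sum, map_smul, smul_apply,
    inner_smul_right, Fintype.sum_prod_type, compression]
  conv_rhs => rw [Finset.sum_comm]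
  exact Finset.sum_congr rfl fun i _ => Finset.sum_comm

/-- The compressions of any representation `ρ` to finitely many vectors are approximated, on
finitely many elements, by sums of compressions of a given faithful representation `π`;
otherwise a separating functional would contradict `re_form_nonneg`. -/
theorem exists_vectors (π : D →⋆ₙₐ[ℂ] (H →L[ℂ] H)) (hπ : Function.Injective π)
    (ρ : D →⋆ₙₐ[ℂ] (K →L[ℂ] K)) (e : n → K) (ω : Finset D) {ε : ℝ} (hε : 0 < ε) :
    ∃ (q : ℕ) (v : Fin q → n → H), ∀ x ∈ ω, ∀ i j,
      ‖∑ k, inner ℂ (v k i) (π x (v k j)) - inner ℂ (e i) (ρ x (e j))‖ < ε := by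
  classical
  have hmem : compression ρ ω e ∈ closure (compressionCone π ω n : Set (ω × n × n → ℂ)) := by
    by_contra hnot
    obtain ⟨f, hf, hf0⟩ := ProperCone.hyperplane_separation_point
      (⟨(compressionCone π ω n).closure, isClosed_closure⟩ : ProperCone ℝ (ω × n × n → ℂ)) hnot
    obtain ⟨y, hy⟩ := real_functional_eq f
    rw [hy, ← sum_inner_eq_sum_compression] at hf0
    refine hf0.not_ge (re_form_nonneg π hπ ρ (fun i j => ∑ x : ω, y (x, i, j) • (x : D)) ?_ e)
    intro v
    rw [sum_inner_eq_sum_compression, ← hy]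
    exact hf _ (subset_closure ⟨[v], by simp⟩)
  rw [Metric.mem_closure_iff] at hmem
  obtain ⟨_, ⟨l, rfl⟩, hl⟩ := hmem ε hε
  refine ⟨l.length, fun k => l.get k, fun x hx i j => ?_⟩
  have h := (dist_pi_lt_iff hε).1 hl (⟨x, hx⟩, i, j)
  rw [dist_comm, dist_eq_norm] at h
  have hsum : (l.map (compression π ω)).sum = ∑ k : Fin l.length, compression π ω (l.get k) := by
    rw [← Fin.sum_univ_fun_getElem]
    rfl
  rwa [hsum, Finset.sum_apply] at h

omit [CompleteSpace H] in
theorem inner_sum_smul (T : H →L[ℂ] H) (c d : n → ℂ) (v w : n → H) :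
    inner ℂ (∑ i, c i • v i) (T (∑ j, d j • w j)) =
      ∑ i, ∑ j, (starRingEnd ℂ) (c i) * (d j * inner ℂ (v i) (T (w j))) := by
  simp only [map_sum, map_smul, sum_inner, inner_sum, inner_smul_left, inner_smul_right,
    Finset.mul_sum]
  rw [Finset.sum_comm]
  exact Finset.sum_congr rfl fun i _ => Finset.sum_congr rfl fun j _ => mul_left_comm _ _ _

theorem norm_sesquilinear_le (z : n → n → ℂ) {ε : ℝ} (hz : ∀ i j, ‖z i j‖ ≤ ε) (c d : n → ℂ) :
    ‖∑ i, ∑ j, (starRingEnd ℂ) (c i) * (d j * z i j)‖ ≤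
      ε * (Fintype.card n * (√(∑ i, ‖c i‖ ^ 2) * √(∑ i, ‖d i‖ ^ 2))) := by
  rcases isEmpty_or_nonempty n with hn | ⟨⟨k⟩⟩
  · simp
  have hε : 0 ≤ ε := (norm_nonneg _).trans (hz k k)
  have h1 : ∀ c : n → ℂ, ∑ i, ‖c i‖ ≤ √(Fintype.card n) * √(∑ i, ‖c i‖ ^ 2) := fun c => by
    rw [← Real.sqrt_mul (Nat.cast_nonneg _)]
    exact Real.le_sqrt_of_sq_le (sq_sum_le_card_mul_sum_sq (s := Finset.univ) (f := fun i => ‖c i‖))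
  calc ‖∑ i, ∑ j, (starRingEnd ℂ) (c i) * (d j * z i j)‖
      ≤ ∑ i, ∑ j, ‖c i‖ * (‖d j‖ * ε) := by
        refine norm_sum_le_of_le _ fun i _ => norm_sum_le_of_le _ fun j _ => ?_
        rw [norm_mul, norm_mul, RCLike.norm_conj]
        gcongr
        exact hz i j
    _ = ε * ((∑ i, ‖c i‖) * ∑ j, ‖d j‖) := by
        rw [Finset.sum_mul_sum, Finset.mul_sum]
        refine Finset.sum_congr rfl fun i _ => ?_
        rw [Finset.mul_sum]
        exact Finset.sum_congr rfl fun j _ => by ring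
    _ ≤ ε * ((√(Fintype.card n) * √(∑ i, ‖c i‖ ^ 2)) *
          (√(Fintype.card n) * √(∑ i, ‖d i‖ ^ 2))) := by
        gcongr
        exacts [h1 c, h1 d]
    _ = _ := by
        have := Real.mul_self_sqrt (Nat.cast_nonneg (α := ℝ) (Fintype.card n))
        linear_combination ε * √(∑ i, ‖c i‖ ^ 2) * √(∑ i, ‖d i‖ ^ 2) * this

omit [PartialOrder D] [StarOrderedRing D] in
theorem norm_sq_apply_of_isSelfAdjoint (π : D →⋆ₙₐ[ℂ] (H →L[ℂ] H)) {c : D}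
    (hc : IsSelfAdjoint c) (a : H) : ((‖π c a‖ : ℝ) : ℂ) ^ 2 = inner ℂ a (π (c * c) a) := by
  refine (inner_self_eq_norm_sq_to_K (𝕜 := ℂ) (π c a)).symm.trans ?_
  rw [map_mul, ← ContinuousLinearMap.adjoint_inner_right, ← ContinuousLinearMap.star_eq_adjoint,
    ← map_star, hc.star_eq]
  rfl

theorem exists_approximate_unit (ω : Finset D) {ε : ℝ} (hε : 0 < ε) :
    ∃ c : D, IsSelfAdjoint c ∧ ‖c‖ ≤ 1 ∧ ∀ x ∈ ω, ‖c * x * c - x‖ ≤ ε := by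
  have hu := CStarAlgebra.increasingApproximateUnit D
  have : (CStarAlgebra.approximateUnit D).NeBot := hu.neBot
  have h1 : ∀ᶠ c in CStarAlgebra.approximateUnit D, ∀ x ∈ ω,
      ‖c * x - x‖ ≤ ε / 2 ∧ ‖x * c - x‖ ≤ ε / 2 := by
    rw [Filter.eventually_all_finset]
    intro x _
    have hl := (hu.tendsto_mul_right x).sub_const x
    have hr := (hu.tendsto_mul_left x).sub_const x
    rw [sub_self] at hl hr
    have hl' := hl.norm.eventually_le_const (show ‖(0 : D)‖ < ε / 2 by simpa using hε)
    have hr' := hr.norm.eventually_le_const (show ‖(0 : D)‖ < ε / 2 by simpa using hε)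
    filter_upwards [hl', hr'] with c a b
    exact ⟨a, b⟩
  obtain ⟨c, hc, hn, hs⟩ := (h1.and (hu.eventually_norm.and hu.eventually_isSelfAdjoint)).exists
  refine ⟨c, hs, hn, fun x hx => ?_⟩
  obtain ⟨a, b⟩ := hc x hx
  calc ‖c * x * c - x‖ = ‖(c * x - x) * c + (x * c - x)‖ := by noncomm_ring
    _ ≤ ‖(c * x - x) * c‖ + ‖x * c - x‖ := norm_add_le _ _
    _ ≤ ‖c * x - x‖ * ‖c‖ + ‖x * c - x‖ := by gcongr; exact norm_mul_le _ _
    _ ≤ ε / 2 * 1 + ε / 2 := by gcongr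
    _ = ε := by ring

/-- The vectors in `exists_vectors` may be chosen to define contractions: compress `π` and `ρ`
by an element of an approximate unit, and rescale. -/
theorem exists_contractive_vectors (π : D →⋆ₙₐ[ℂ] (H →L[ℂ] H)) (hπ : Function.Injective π)
    (ρ : D →⋆ₙₐ[ℂ] (K →L[ℂ] K)) (e : n → K) (he : Orthonormal ℂ e) (ω : Finset D) {ε : ℝ}
    (hε : 0 < ε) :
    ∃ (q : ℕ) (v : Fin q → n → H),
      (∀ x ∈ ω, ∀ i j,
        ‖∑ k, inner ℂ (v k i) (π x (v k j)) - inner ℂ (e i) (ρ x (e j))‖ ≤ ε) ∧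
      ∀ c : n → ℂ, ∑ k, ‖∑ i, c i • v k i‖ ^ 2 ≤ ∑ i, ‖c i‖ ^ 2 := by
  classical
  obtain ⟨M, hM0, hM⟩ : ∃ M : ℝ, 0 ≤ M ∧ ∀ x ∈ ω, ‖x‖ ≤ M :=
    ⟨∑ x ∈ ω, ‖x‖, by positivity, fun x hx =>
      Finset.single_le_sum (f := fun x => ‖x‖) (fun _ _ => norm_nonneg _) hx⟩
  set N : ℝ := (Fintype.card n : ℝ) with hN
  have hN0 : 0 ≤ N := Nat.cast_nonneg _
  obtain ⟨δ, hδ, hδε⟩ : ∃ δ : ℝ, 0 < δ ∧ δ * (2 + N * M) ≤ ε :=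
    ⟨ε / (2 + N * M), by positivity, by rw [div_mul_cancel₀]; positivity⟩
  obtain ⟨c₀, hsa, hc₀, happ⟩ := exists_approximate_unit ω hδ
  obtain ⟨q, v, hv⟩ := exists_vectors π hπ ρ e (insert (c₀ * c₀) (ω.image fun x => c₀ * x * c₀)) hδ
  have hρ : ∀ x, ‖ρ x‖ ≤ ‖x‖ := NonUnitalStarAlgHom.norm_apply_le ρ
  have hcomp : ∀ (x : D) (a b : H), inner ℂ (π c₀ a) (π x (π c₀ b)) =
      inner ℂ a (π (c₀ * x * c₀) b) := fun x a b => by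
    rw [← ContinuousLinearMap.adjoint_inner_right, ← ContinuousLinearMap.star_eq_adjoint,
      ← map_star, hsa.star_eq, map_mul, map_mul]
    rfl
  set s : ℝ := (√(1 + N * δ))⁻¹ with hs
  have h1 : 1 ≤ 1 + N * δ := by nlinarith
  have hs2 : s ^ 2 = (1 + N * δ)⁻¹ := by rw [hs, inv_pow, Real.sq_sqrt (by positivity)]
  have hs0 : 0 ≤ s ^ 2 := sq_nonneg s
  have hs1 : s ^ 2 ≤ 1 := by rw [hs2]; exact inv_le_one_of_one_le₀ h1
  have hs3 : 1 - s ^ 2 ≤ N * δ := by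
    rw [hs2, ← sub_nonneg]
    have : N * δ - (1 - (1 + N * δ)⁻¹) = (N * δ) ^ 2 * (1 + N * δ)⁻¹ := by
      field_simp
      ring
    rw [this]
    positivity
  refine ⟨q, fun k i => (s : ℂ) • π c₀ (v k i), fun x hx i j => ?_, fun c => ?_⟩
  · have hb : ‖inner ℂ (e i) (ρ x (e j))‖ ≤ M := by
      refine (norm_inner_le_norm _ _).trans ?_
      rw [he.1 i, one_mul]
      refine ((ρ x).le_opNorm _).trans ?_
      rw [he.1 j, mul_one]
      exact (hρ x).trans (hM x hx)
    have ha := hv (c₀ * x * c₀)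
      (Finset.mem_insert_of_mem (Finset.mem_image_of_mem (fun x => c₀ * x * c₀) hx)) i j
    have hab : ‖inner ℂ (e i) (ρ (c₀ * x * c₀) (e j)) - inner ℂ (e i) (ρ x (e j))‖ ≤ δ := by
      rw [← inner_sub_right, ← sub_apply, ← map_sub]
      refine (norm_inner_le_norm _ _).trans ?_
      rw [he.1 i, one_mul]
      refine ((ρ _).le_opNorm _).trans ?_
      rw [he.1 j, mul_one]
      exact (hρ _).trans (happ x hx)
    have hsum : ∑ k, inner ℂ ((s : ℂ) • π c₀ (v k i)) (π x ((s : ℂ) • π c₀ (v k j))) =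
        ((s ^ 2 : ℝ) : ℂ) * ∑ k, inner ℂ (v k i) (π (c₀ * x * c₀) (v k j)) := by
      rw [Finset.mul_sum]
      refine Finset.sum_congr rfl fun k _ => ?_
      rw [map_smul, inner_smul_left, inner_smul_right, hcomp, Complex.conj_ofReal]
      push_cast
      ring
    rw [hsum]
    set a := ∑ k, inner ℂ (v k i) (π (c₀ * x * c₀) (v k j))
    set b₀ := inner ℂ (e i) (ρ (c₀ * x * c₀) (e j))
    set b := inner ℂ (e i) (ρ x (e j))
    calc ‖((s ^ 2 : ℝ) : ℂ) * a - b‖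
        = ‖((s ^ 2 : ℝ) : ℂ) * (a - b₀) + ((s ^ 2 : ℝ) : ℂ) * (b₀ - b)
            - ((1 - s ^ 2 : ℝ) : ℂ) * b‖ := by
          congr 1
          push_cast
          ring
      _ ≤ ‖((s ^ 2 : ℝ) : ℂ) * (a - b₀)‖ + ‖((s ^ 2 : ℝ) : ℂ) * (b₀ - b)‖
            + ‖((1 - s ^ 2 : ℝ) : ℂ) * b‖ :=
          (norm_sub_le _ _).trans (add_le_add_left (norm_add_le _ _) _)
      _ = s ^ 2 * ‖a - b₀‖ + s ^ 2 * ‖b₀ - b‖ + (1 - s ^ 2) * ‖b‖ := by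
          rw [norm_mul, norm_mul, norm_mul, Complex.norm_real, Complex.norm_real,
            Real.norm_of_nonneg hs0, Real.norm_of_nonneg (sub_nonneg.2 hs1)]
      _ ≤ 1 * δ + 1 * δ + N * δ * M := by
          gcongr
      _ ≤ ε := by linarith
  · have hck := hv (c₀ * c₀) (Finset.mem_insert_self _ _)
    have hform := fun a => norm_sq_apply_of_isSelfAdjoint π hsa a
    have hformρ := fun a => norm_sq_apply_of_isSelfAdjoint ρ hsa a
    set S := ∑ i, ‖c i‖ ^ 2 with hS
    have hS0 : 0 ≤ S := by positivity
    have hρS : ‖ρ c₀ (∑ i, c i • e i)‖ ^ 2 ≤ S := by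
      have hnorm : ‖∑ i, c i • e i‖ ^ 2 = S := by
        rw [@norm_sq_eq_re_inner ℂ, he.inner_sum]
        simp only [hS, map_sum]
        refine Finset.sum_congr rfl fun i _ => ?_
        rw [mul_comm, RCLike.mul_conj]
        norm_cast
      rw [← hnorm]
      gcongr
      refine ((ρ c₀).le_opNorm _).trans ?_
      exact mul_le_of_le_one_left (norm_nonneg _) ((hρ c₀).trans hc₀)
    have hdiff : ‖∑ k, inner ℂ (∑ i, c i • v k i) (π (c₀ * c₀) (∑ i, c i • v k i)) -
        inner ℂ (∑ i, c i • e i) (ρ (c₀ * c₀) (∑ i, c i • e i))‖ ≤ δ * (N * S) := by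
      have := norm_sesquilinear_le
        (fun i j => ∑ k, inner ℂ (v k i) (π (c₀ * c₀) (v k j)) - inner ℂ (e i) (ρ (c₀ * c₀) (e j)))
        (fun i j => (hck i j).le) c c
      rw [Real.mul_self_sqrt hS0] at this
      convert this using 2
      simp only [inner_sum_smul, mul_sub, Finset.mul_sum, Finset.sum_sub_distrib]
      congr 1
      rw [Finset.sum_comm]
      exact Finset.sum_congr rfl fun i _ => Finset.sum_comm
    have hmain : ∑ k, ‖π c₀ (∑ i, c i • v k i)‖ ^ 2 ≤ S * (1 + N * δ) := by
      simp only [← hform, ← hformρ] at hdiff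
      have h2 : ∑ k, ((‖π c₀ (∑ i, c i • v k i)‖ : ℝ) : ℂ) ^ 2 -
          ((‖ρ c₀ (∑ i, c i • e i)‖ : ℝ) : ℂ) ^ 2 =
          ((∑ k, ‖π c₀ (∑ i, c i • v k i)‖ ^ 2 - ‖ρ c₀ (∑ i, c i • e i)‖ ^ 2 : ℝ) : ℂ) := by
        push_cast
        rfl
      rw [h2, Complex.norm_real] at hdiff
      have := (le_abs_self _).trans hdiff
      nlinarith
    have hscale : ∀ k, ‖∑ i, c i • (s : ℂ) • π c₀ (v k i)‖ ^ 2 =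
        s ^ 2 * ‖π c₀ (∑ i, c i • v k i)‖ ^ 2 := fun k => by
      rw [← sq_abs s, ← mul_pow, ← Real.norm_eq_abs, ← Complex.norm_real, ← norm_smul, map_sum,
        Finset.smul_sum]
      simp only [map_smul, smul_comm (c _) (s : ℂ)]
    simp only [hscale]
    rw [← Finset.mul_sum, hs2, inv_mul_le_iff₀ (by positivity)]
    linarith

end Separation

/-! ### Independence of the representation -/

section WeakLimit

variable {K : Type*} [NormedAddCommGroup K] [InnerProductSpace ℂ K]

theorem norm_le_of_inner_le (T : K →L[ℂ] K) {C : ℝ} (hC : 0 ≤ C)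
    (h : ∀ ξ η, ‖inner ℂ ξ (T η)‖ ≤ C * ‖ξ‖ * ‖η‖) : ‖T‖ ≤ C := by
  refine T.opNorm_le_bound hC fun η => ?_
  have h1 := h (T η) η
  rw [inner_self_eq_norm_sq_to_K, norm_pow, RCLike.norm_ofReal, abs_norm, sq] at h1
  rcases (norm_nonneg (T η)).eq_or_lt with h0 | h0
  · rw [← h0]
    positivity
  · refine le_of_mul_le_mul_left ?_ h0
    linarith

variable [CompleteSpace K]

/-- Weak operator compactness of the balls of `B(K)`. -/
theorem exists_weak_limit {ι : Type*} (U : Ultrafilter ι) (T : ι → K →L[ℂ] K) {C : ℝ}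
    (hT : ∀ i, ‖T i‖ ≤ C) :
    ∃ S : K →L[ℂ] K, ∀ ξ η, Tendsto (fun i => inner ℂ ξ (T i η)) U (𝓝 (inner ℂ ξ (S η))) := by
  have hbd : ∀ ξ η i, ‖inner ℂ ξ (T i η)‖ ≤ C * ‖ξ‖ * ‖η‖ := fun ξ η i => by
    refine (norm_inner_le_norm _ _).trans ?_
    have := ((T i).le_opNorm η).trans (mul_le_mul_of_nonneg_right (hT i) (norm_nonneg η))
    calc ‖ξ‖ * ‖T i η‖ ≤ ‖ξ‖ * (C * ‖η‖) := by gcongr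
      _ = _ := by ring
  have hlim : ∀ ξ η, ∃ z, ‖z‖ ≤ C * ‖ξ‖ * ‖η‖ ∧
      Tendsto (fun i => inner ℂ ξ (T i η)) U (𝓝 z) := fun ξ η => by
    obtain ⟨z, hz, hle⟩ := (isCompact_closedBall (0 : ℂ) (C * ‖ξ‖ * ‖η‖)).ultrafilter_le_nhds
      (U.map fun i => inner ℂ ξ (T i η)) (by
        rw [le_principal_iff]
        exact Filter.mem_map.2 (Filter.univ_mem' fun i => by simpa using hbd ξ η i))
    exact ⟨z, by simpa using hz, hle⟩
  choose L hL hLt using hlim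
  -- The limit of `⟪T η, ξ⟫` is conjugate linear in `η` and linear in `ξ`.
  let B : K →L⋆[ℂ] K →L[ℂ] ℂ := LinearMap.mkContinuous₂
    (LinearMap.mk₂'ₛₗ (starRingEnd ℂ) (RingHom.id ℂ) (fun η ξ => (starRingEnd ℂ) (L ξ η))
      (fun η η' ξ => by
        rw [← map_add, tendsto_nhds_unique (hLt ξ (η + η'))
          (by simpa [inner_add_right] using (hLt ξ η).add (hLt ξ η'))])
      (fun c η ξ => by
        rw [tendsto_nhds_unique (hLt ξ (c • η))
          (by simpa [inner_smul_right] using (hLt ξ η).const_mul c)]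
        simp)
      (fun η ξ ξ' => by
        rw [← map_add, tendsto_nhds_unique (hLt (ξ + ξ') η)
          (by simpa [inner_add_left] using (hLt ξ η).add (hLt ξ' η))])
      (fun c η ξ => by
        rw [tendsto_nhds_unique (hLt (c • ξ) η)
          (by simpa [inner_smul_left, mul_comm] using (hLt ξ η).const_mul ((starRingEnd ℂ) c))]
        simp [mul_comm]))
    C (fun η ξ => by
      rw [LinearMap.mk₂'ₛₗ_apply, RCLike.norm_conj]
      refine (hL ξ η).trans_eq (by ring))
  refine ⟨InnerProductSpace.continuousLinearMapOfBilin B, fun ξ η => ?_⟩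
  have : inner ℂ ξ (InnerProductSpace.continuousLinearMapOfBilin B η) = L ξ η := by
    rw [← inner_conj_symm, InnerProductSpace.continuousLinearMapOfBilin_apply]
    exact Complex.conj_conj _
  rw [this]
  exact hLt ξ η

end WeakLimit

section Transfer

variable {D : Type*} [NonUnitalCStarAlgebra D] [PartialOrder D] [StarOrderedRing D]
  {B : Type*} [NonUnitalCStarAlgebra B] [PartialOrder B] [StarOrderedRing B]
  {H : Type*} [NormedAddCommGroup H] [InnerProductSpace ℂ H] [CompleteSpace H]
  {K : Type*} [NormedAddCommGroup K] [InnerProductSpace ℂ K] [CompleteSpace K]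

/-- The map `b ↦ ∑ W⋆ ψ(b) W` for finitely many operators `W : K → H`. -/
def conjSum {q : ℕ} (W : Fin q → K →L[ℂ] H) (ψ : B →CP (H →L[ℂ] H)) : B →ₗ[ℂ] (K →L[ℂ] K) where
  toFun b := ∑ k, (W k).adjoint ∘L ψ b ∘L W k
  map_add' a b := by
    simp [ContinuousLinearMap.comp_add, ContinuousLinearMap.add_comp, Finset.sum_add_distrib]
  map_smul' c a := by
    simp [Finset.smul_sum]

theorem inner_conjSum {q : ℕ} (W : Fin q → K →L[ℂ] H) (ψ : B →CP (H →L[ℂ] H)) (b : B) (ξ η : K) :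
    inner ℂ ξ (conjSum W ψ b η) = ∑ k, inner ℂ (W k ξ) (ψ b (W k η)) := by
  simp [conjSum, ContinuousLinearMap.adjoint_inner_right]

theorem conjSum_kernel_nonneg {q : ℕ} (W : Fin q → K →L[ℂ] H) (ψ : B →CP (H →L[ℂ] H)) {n : ℕ}
    (x : Fin n → B) (ξ : Fin n → K) :
    0 ≤ ∑ i, ∑ j, inner ℂ (ξ i) (conjSum W ψ (star (x i) * x j) (ξ j)) := by
  have : ∑ i, ∑ j, inner ℂ (ξ i) (conjSum W ψ (star (x i) * x j) (ξ j)) =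
      ∑ k, ∑ i, ∑ j, inner ℂ (W k (ξ i)) (ψ (star (x i) * x j) (W k (ξ j))) := by
    simp only [inner_conjSum]
    conv_rhs => rw [Finset.sum_comm]
    exact Finset.sum_congr rfl fun i _ => Finset.sum_comm
  rw [this]
  exact Finset.sum_nonneg fun k _ => cp_kernel_nonneg ψ x _

omit [CompleteSpace H] [CompleteSpace K] in
theorem norm_sum_inner_le {q : ℕ} (W : Fin q → K →L[ℂ] H)
    (hW : ∀ ξ, ∑ k, ‖W k ξ‖ ^ 2 ≤ ‖ξ‖ ^ 2) (T : H →L[ℂ] H) (ξ η : K) :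
    ‖∑ k, inner ℂ (W k ξ) (T (W k η))‖ ≤ ‖T‖ * ‖ξ‖ * ‖η‖ := by
  calc ‖∑ k, inner ℂ (W k ξ) (T (W k η))‖ ≤ ∑ k, ‖W k ξ‖ * (‖T‖ * ‖W k η‖) := by
        refine norm_sum_le_of_le _ fun k _ => (norm_inner_le_norm _ _).trans ?_
        gcongr
        exact T.le_opNorm _
    _ = ‖T‖ * ∑ k, ‖W k ξ‖ * ‖W k η‖ := by
        rw [Finset.mul_sum]
        exact Finset.sum_congr rfl fun k _ => by ring
    _ ≤ ‖T‖ * (√(∑ k, ‖W k ξ‖ ^ 2) * √(∑ k, ‖W k η‖ ^ 2)) := by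
        gcongr
        exact Real.sum_mul_le_sqrt_mul_sqrt _ _ _
    _ ≤ ‖T‖ * (‖ξ‖ * ‖η‖) := by
        gcongr
        · exact Real.sqrt_le_iff.2 ⟨norm_nonneg _, hW ξ⟩
        · exact Real.sqrt_le_iff.2 ⟨norm_nonneg _, hW η⟩
    _ = _ := by ring

/-- An approximation `ψ ∘ φ` of a faithful representation `π` is carried to an approximation of
any representation `ρ` on a given finite dimensional subspace, with the same `φ`. -/
theorem exists_approximation_on_subspace (π : D →⋆ₙₐ[ℂ] (H →L[ℂ] H)) (hπ : Function.Injective π)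
    (ρ : D →⋆ₙₐ[ℂ] (K →L[ℂ] K)) (φ : D → B) (ψ : B →CP (H →L[ℂ] H)) (hψ : ∀ b, ‖ψ b‖ ≤ ‖b‖)
    (ω : Finset D) {δ δ' : ℝ} (hδ : δ < δ') (h : ∀ x ∈ ω, ‖ψ (φ x) - π x‖ ≤ δ)
    (F : Submodule ℂ K) [FiniteDimensional ℂ F] :
    ∃ θ : B →ₗ[ℂ] (K →L[ℂ] K),
      (∀ (n : ℕ) (x : Fin n → B) (ξ : Fin n → K),
        0 ≤ ∑ i, ∑ j, inner ℂ (ξ i) (θ (star (x i) * x j) (ξ j))) ∧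
      (∀ b, ‖θ b‖ ≤ ‖b‖) ∧
      ∀ x ∈ ω, ∀ ξ ∈ F, ∀ η ∈ F, ‖inner ℂ ξ (θ (φ x) η) - inner ℂ ξ (ρ x η)‖ ≤ δ' * ‖ξ‖ * ‖η‖ := by
  let b := stdOrthonormalBasis ℂ F
  set n := Module.finrank ℂ F
  let e : Fin n → K := fun i => (b i : K)
  have he : Orthonormal ℂ e := b.orthonormal.comp_linearIsometry F.subtypeₗᵢ
  have hF : ∀ ξ ∈ F, ξ = ∑ i, inner ℂ (e i) ξ • e i := fun ξ hξ => by
    have := congrArg (fun z : F => (z : K)) (b.sum_repr' ⟨ξ, hξ⟩)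
    simpa [e] using this.symm
  have hB : ∀ ξ, ∑ i, ‖inner ℂ (e i) ξ‖ ^ 2 ≤ ‖ξ‖ ^ 2 := fun ξ =>
    he.sum_inner_products_le ξ
  obtain ⟨ε, hε, hεδ⟩ : ∃ ε : ℝ, 0 < ε ∧ ε * n ≤ δ' - δ :=
    ⟨(δ' - δ) / (n + 1), div_pos (sub_pos.2 hδ) (by positivity), by
      rw [div_mul_eq_mul_div, div_le_iff₀ (by positivity)]
      nlinarith⟩
  obtain ⟨q, v, hv, hc⟩ := exists_contractive_vectors π hπ ρ e he ω hε
  let W : Fin q → K →L[ℂ] H := fun k =>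
    ∑ i, (innerSL ℂ (e i)).smulRight (v k i)
  have hWapp : ∀ k ξ, W k ξ = ∑ i, inner ℂ (e i) ξ • v k i := fun k ξ => by
    simp [W]
  have hW : ∀ ξ, ∑ k, ‖W k ξ‖ ^ 2 ≤ ‖ξ‖ ^ 2 := fun ξ => by
    simp only [hWapp]
    exact (hc fun i => inner ℂ (e i) ξ).trans (hB ξ)
  refine ⟨conjSum W ψ, fun n x ξ => conjSum_kernel_nonneg W ψ x ξ, fun b => ?_,
    fun x hx ξ hξ η hη => ?_⟩
  · refine norm_le_of_inner_le _ (norm_nonneg _) fun ξ η => ?_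
    rw [inner_conjSum]
    refine (norm_sum_inner_le W hW _ ξ η).trans ?_
    gcongr
    exact hψ b
  · have h1 : ‖∑ k, inner ℂ (W k ξ) ((ψ (φ x) - π x) (W k η))‖ ≤ δ * ‖ξ‖ * ‖η‖ := by
      refine (norm_sum_inner_le W hW _ ξ η).trans ?_
      gcongr
      exact h x hx
    have h2 : ‖∑ k, inner ℂ (W k ξ) (π x (W k η)) - inner ℂ ξ (ρ x η)‖ ≤
        (δ' - δ) * ‖ξ‖ * ‖η‖ := by
      have := norm_sesquilinear_le
        (fun i j => ∑ k, inner ℂ (v k i) (π x (v k j)) - inner ℂ (e i) (ρ x (e j)))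
        (hv x hx) (fun i => inner ℂ (e i) ξ) (fun i => inner ℂ (e i) η)
      calc _ = _ := ?_
        _ ≤ _ := this
        _ ≤ ε * (n * (‖ξ‖ * ‖η‖)) := ?_
        _ = ε * n * ‖ξ‖ * ‖η‖ := by ring
        _ ≤ _ := by gcongr
      · congr 1
        conv_lhs => rw [hF ξ hξ, hF η hη, inner_sum_smul]
        rw [← hF ξ hξ, ← hF η hη]
        simp only [hWapp, inner_sum_smul, mul_sub, Finset.mul_sum, Finset.sum_sub_distrib]
        congr 1
        rw [Finset.sum_comm]
        exact Finset.sum_congr rfl fun i _ => Finset.sum_comm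
      · rw [Fintype.card_fin]
        gcongr
        · exact Real.sqrt_le_iff.2 ⟨norm_nonneg _, hB ξ⟩
        · exact Real.sqrt_le_iff.2 ⟨norm_nonneg _, hB η⟩
    have h3 : inner ℂ ξ (conjSum W ψ (φ x) η) - inner ℂ ξ (ρ x η) =
        ∑ k, inner ℂ (W k ξ) ((ψ (φ x) - π x) (W k η)) +
          (∑ k, inner ℂ (W k ξ) (π x (W k η)) - inner ℂ ξ (ρ x η)) := by
      rw [inner_conjSum]
      simp only [sub_apply, inner_sub_right, Finset.sum_sub_distrib]
      ring
    rw [h3]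
    refine (norm_add_le _ _).trans ((add_le_add h1 h2).trans_eq (by ring))

/-- An approximation `ψ ∘ φ` of a faithful representation is carried to an approximation
of any representation, with the same `φ`: take a weak limit of
`exists_approximation_on_subspace` over all finite dimensional subspaces. -/
theorem exists_transfer (π : D →⋆ₙₐ[ℂ] (H →L[ℂ] H)) (hπ : Function.Injective π)
    (ρ : D →⋆ₙₐ[ℂ] (K →L[ℂ] K)) (φ : D → B) (ψ : B →CP (H →L[ℂ] H)) (hψ : ∀ b, ‖ψ b‖ ≤ ‖b‖)
    (ω : Finset D) {δ δ' : ℝ} (hδ : δ < δ') (hδ' : 0 ≤ δ') (h : ∀ x ∈ ω, ‖ψ (φ x) - π x‖ ≤ δ) :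
    ∃ ψ' : B →CP (K →L[ℂ] K), (∀ b, ‖ψ' b‖ ≤ ‖b‖) ∧ ∀ x ∈ ω, ‖ψ' (φ x) - ρ x‖ ≤ δ' := by
  classical
  choose θ hθ hθn hθa using fun s : Finset K =>
    exists_approximation_on_subspace π hπ ρ φ ψ hψ ω hδ h (Submodule.span ℂ (s : Set K))
  let U : Ultrafilter (Finset K) := Ultrafilter.of atTop
  have hU : (U : Filter (Finset K)) ≤ atTop := Ultrafilter.of_le _
  choose S hS using fun b : B => exists_weak_limit U (fun s => θ s b) (fun s => hθn s b)
  have hext : ∀ T T' : K →L[ℂ] K, (∀ ξ η, inner ℂ ξ (T η) = inner ℂ ξ (T' η)) → T = T' :=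
    fun T T' h => ContinuousLinearMap.ext fun η => ext_inner_left ℂ fun ξ => h ξ η
  let Θ : B →ₗ[ℂ] (K →L[ℂ] K) :=
    { toFun := S
      map_add' := fun a b => hext _ _ fun ξ η => tendsto_nhds_unique (hS (a + b) ξ η)
        (by simpa [inner_add_right] using (hS a ξ η).add (hS b ξ η))
      map_smul' := fun c b => hext _ _ fun ξ η => tendsto_nhds_unique (hS (c • b) ξ η)
        (by simpa [inner_smul_right] using (hS b ξ η).const_mul c) }
  have hΘ : ∀ b ξ η, Tendsto (fun s => inner ℂ ξ (θ s b η)) U (𝓝 (inner ℂ ξ (Θ b η))) := hS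
  refine ⟨cpOfKernel Θ fun n x ξ => ?_, fun b => ?_, fun x hx => ?_⟩
  · have ht : Tendsto (fun s => ∑ i, ∑ j, inner ℂ (ξ i) (θ s (star (x i) * x j) (ξ j))) U
        (𝓝 (∑ i, ∑ j, inner ℂ (ξ i) (Θ (star (x i) * x j) (ξ j)))) :=
      tendsto_finsetSum _ fun i _ => tendsto_finsetSum _ fun j _ => hΘ _ _ _
    exact ge_of_tendsto' ht fun s => hθ s n x ξ
  · refine norm_le_of_inner_le _ (norm_nonneg _) fun ξ η => ?_
    refine le_of_tendsto' (hΘ b ξ η).norm fun s => (norm_inner_le_norm _ _).trans ?_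
    have := ((θ s b).le_opNorm η).trans (mul_le_mul_of_nonneg_right (hθn s b) (norm_nonneg η))
    calc ‖ξ‖ * ‖θ s b η‖ ≤ ‖ξ‖ * (‖b‖ * ‖η‖) := by gcongr
      _ = _ := by ring
  · refine norm_le_of_inner_le _ hδ' fun ξ η => ?_
    rw [sub_apply, inner_sub_right]
    refine le_of_tendsto ((hΘ (φ x) ξ η).sub_const _).norm ?_
    filter_upwards [hU (eventually_ge_atTop ({ξ, η} : Finset K))] with s hs
    exact hθa s x hx ξ (Submodule.subset_span (hs (by simp))) η
      (Submodule.subset_span (hs (by simp)))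

end Transfer

section Independence

variable {D : Type*} [NonUnitalCStarAlgebra D] [PartialOrder D] [StarOrderedRing D]
  {H : Type*} [NormedAddCommGroup H] [InnerProductSpace ℂ H] [CompleteSpace H]
  {K : Type*} [NormedAddCommGroup K] [InnerProductSpace ℂ K] [CompleteSpace K]

/-- A completely positive approximation of a faithful representation gives one of any
representation, through the same finite dimensional algebra. -/
theorem CPA.exists_approximates (T : CPA D H) (π : D →⋆ₙₐ[ℂ] (H →L[ℂ] H))
    (hπ : Function.Injective π) (ρ : D →⋆ₙₐ[ℂ] (K →L[ℂ] K)) {ω : Set D} (hω : ω.Finite) {δ : ℝ}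
    (hδ : 0 < δ) (h : T.Approximates π ω δ) :
    ∃ T' : CPA D K, T'.Approximates ρ ω δ ∧ rank T'.B = rank T.B := by
  -- The supremum of the errors over the finite set `ω` is still smaller than `δ`.
  obtain ⟨δ₁, h1, h2, h3⟩ : ∃ δ₁, 0 ≤ δ₁ ∧ δ₁ < δ ∧ ∀ x ∈ ω, ‖T.ψ (T.φ x) - π x‖ ≤ δ₁ := by
    have : ∀ᶠ d in 𝓝[<] δ, ∀ x ∈ ω, ‖T.ψ (T.φ x) - π x‖ ≤ d := by
      rw [eventually_all_finite hω]
      intro x hx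
      exact (eventually_ge_nhds (h x hx)).filter_mono nhdsWithin_le_nhds
    obtain ⟨d, hd, hd0, hdδ⟩ := (this.and (((eventually_ge_nhds hδ).filter_mono
      nhdsWithin_le_nhds).and self_mem_nhdsWithin)).exists
    exact ⟨d, hd0, hdδ, hd⟩
  obtain ⟨δ₂, h4, h5⟩ := exists_between h2
  obtain ⟨ψ', hψ', ha⟩ := exists_transfer π hπ ρ T.φ T.ψ T.norm_ψ_le hω.toFinset h4
    (h1.trans h4.le) (fun x hx => h3 x (hω.mem_toFinset.1 hx))
  exact ⟨{ T with ψ := ψ', norm_ψ_le := hψ' },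
    fun x hx => (ha x (hω.mem_toFinset.2 hx)).trans_lt h5, rfl⟩

theorem rcp_le_of_approximates (T : CPA D H) (π : D →⋆ₙₐ[ℂ] (H →L[ℂ] H)) {ω : Set D} {δ : ℝ}
    (h : T.Approximates π ω δ) : rcp π ω δ ≤ rank T.B :=
  iInf₂_le T h

theorem rcp_mono (π : D →⋆ₙₐ[ℂ] (H →L[ℂ] H)) {ω ω' : Set D} (δ : ℝ) (h : ω ⊆ ω') :
    rcp π ω δ ≤ rcp π ω' δ :=
  le_iInf₂ fun T hT => rcp_le_of_approximates T π fun x hx => hT x (h hx)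

theorem rcp_le_rcp (π : D →⋆ₙₐ[ℂ] (H →L[ℂ] H)) (hπ : Function.Injective π)
    (ρ : D →⋆ₙₐ[ℂ] (K →L[ℂ] K)) {ω : Set D} (hω : ω.Finite) {δ : ℝ} (hδ : 0 < δ) :
    rcp ρ ω δ ≤ rcp π ω δ := by
  refine le_iInf₂ fun T hT => ?_
  obtain ⟨T', hT', hr⟩ := T.exists_approximates π hπ ρ hω hδ hT
  rw [← hr]
  exact rcp_le_of_approximates T' ρ hT'

/-- The completely positive rank of a finite set does not depend on the faithful
representation. -/
theorem rcp_eq_rcp (π : D →⋆ₙₐ[ℂ] (H →L[ℂ] H)) (hπ : Function.Injective π)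
    (ρ : D →⋆ₙₐ[ℂ] (K →L[ℂ] K)) (hρ : Function.Injective ρ) {ω : Set D} (hω : ω.Finite) {δ : ℝ}
    (hδ : 0 < δ) : rcp π ω δ = rcp ρ ω δ :=
  le_antisymm (rcp_le_rcp ρ hρ π hω hδ) (rcp_le_rcp π hπ ρ hω hδ)

omit [PartialOrder D] [StarOrderedRing D] in
theorem finite_orbit (α : D ≃⋆ₐ[ℂ] D) (ω : Finset D) (m : ℕ) :
    (⋃ i ∈ Set.Iio m, (α ^ i : D ≃⋆ₐ[ℂ] D) '' (ω : Set D)).Finite :=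
  (Set.finite_Iio m).biUnion fun _ _ => ω.finite_toSet.image _

theorem ht_eq_ht (π : D →⋆ₙₐ[ℂ] (H →L[ℂ] H)) (hπ : Function.Injective π)
    (ρ : D →⋆ₙₐ[ℂ] (K →L[ℂ] K)) (hρ : Function.Injective ρ) (α : D ≃⋆ₐ[ℂ] D) :
    ht π α = ht ρ α := by
  refine iSup_congr fun ω => iSup_congr fun δ => iSup_congr fun hδ => ?_
  simp only [htAt, rcp_eq_rcp π hπ ρ hρ (finite_orbit α ω _) hδ]

/-- An automorphism preserves the completely positive rank of a finite set, since composing a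
faithful representation with it gives another faithful representation. -/
theorem rcp_image (π : D →⋆ₙₐ[ℂ] (H →L[ℂ] H)) (hπ : Function.Injective π) (β : D ≃⋆ₐ[ℂ] D)
    {ω : Set D} (hω : ω.Finite) {δ : ℝ} (hδ : 0 < δ) : rcp π (β '' ω) δ ≤ rcp π ω δ := by
  let β' : D →⋆ₙₐ[ℂ] D := (β.symm : D →⋆ₙₐ[ℂ] D)
  have hβ' : ∀ x, β' x = β.symm x := fun _ => rfl
  rw [rcp_eq_rcp π hπ (π.comp β') (hπ.comp β.symm.injective) (hω.image β) hδ]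
  refine le_iInf₂ fun T hT => ?_
  let T' : CPA D H :=
    { T with
      φ := cpComp T.φ (cpOfHom β')
      norm_φ_le := fun a => (T.norm_φ_le _).trans (NonUnitalStarAlgHom.norm_apply_le β' a) }
  refine rcp_le_of_approximates T' _ ?_
  rintro _ ⟨x, hx, rfl⟩
  have : β' (β x) = x := by rw [hβ', StarAlgEquiv.symm_apply_apply]
  change ‖T.ψ (T.φ (β' (β x))) - π (β' (β x))‖ < δ
  rw [this]
  exact hT x hx

theorem ht_le_ht_inv (π : D →⋆ₙₐ[ℂ] (H →L[ℂ] H)) (hπ : Function.Injective π) (α : D ≃⋆ₐ[ℂ] D) :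
    ht π α ≤ ht π α⁻¹ := by
  refine iSup_mono fun ω => iSup₂_mono fun δ hδ => ?_
  refine limsup_le_limsup (Eventually.of_forall fun m => ?_)
  refine EReal.div_le_div_right_of_nonneg (by positivity) (ENNReal.log_monotone ?_)
  refine ENat.toENNReal_mono ?_
  refine (rcp_mono π δ ?_).trans (rcp_image π hπ (α ^ (m - 1)) (finite_orbit α⁻¹ ω m) hδ)
  rintro _ hx
  simp only [Set.mem_iUnion, Set.mem_Iio] at hx
  obtain ⟨i, hi, a, ha, rfl⟩ := hx
  refine ⟨(α⁻¹ ^ (m - 1 - i) : D ≃⋆ₐ[ℂ] D) a, ?_, ?_⟩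
  · simp only [Set.mem_iUnion, Set.mem_Iio]
    exact ⟨m - 1 - i, by omega, a, ha, rfl⟩
  · rw [← StarAlgEquiv.mul_apply]
    congr 1
    rw [inv_pow, mul_inv_eq_iff_eq_mul, ← pow_add]
    congr 1
    omega

theorem ht_inv (π : D →⋆ₙₐ[ℂ] (H →L[ℂ] H)) (hπ : Function.Injective π) (α : D ≃⋆ₐ[ℂ] D) :
    ht π α⁻¹ = ht π α :=
  le_antisymm (by simpa using ht_le_ht_inv π hπ α⁻¹) (ht_le_ht_inv π hπ α)

end Independence

/-! ### The rank of a finite dimensional C⋆-algebra -/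

section Rank

variable {B : Type*} [CStarAlgebra B] [FiniteDimensional ℂ B]

/-- The dimensions of the maximal abelian ⋆-subalgebras are bounded by the dimension of `B`. -/
theorem finrank_le_rank_of_maximal {E : StarSubalgebra ℂ B}
    (h : Maximal (fun E : StarSubalgebra ℂ B => ∀ x ∈ E, ∀ y ∈ E, x * y = y * x) E) :
    Module.finrank ℂ E ≤ rank B := by
  refine le_csSup ⟨Module.finrank ℂ B, ?_⟩ ⟨E, h, rfl⟩
  rintro _ ⟨D, _, rfl⟩
  exact Submodule.finrank_le (Subalgebra.toSubmodule D.toSubalgebra)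

/-- An abelian ⋆-subalgebra of a finite dimensional C⋆-algebra is contained in a maximal one,
namely in one of largest dimension among those containing it. -/
theorem finrank_le_rank {E : StarSubalgebra ℂ B} (h : ∀ x ∈ E, ∀ y ∈ E, x * y = y * x) :
    Module.finrank ℂ E ≤ rank B := by
  let P : StarSubalgebra ℂ B → Prop := fun E => ∀ x ∈ E, ∀ y ∈ E, x * y = y * x
  have hmono : ∀ {D D' : StarSubalgebra ℂ B}, D ≤ D' →
      Module.finrank ℂ D ≤ Module.finrank ℂ D' := fun {D D'} hle =>
    Submodule.finrank_mono (s := Subalgebra.toSubmodule D.toSubalgebra)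
      (t := Subalgebra.toSubmodule D'.toSubalgebra) hle
  have hbdd : BddAbove {r | ∃ D, E ≤ D ∧ P D ∧ Module.finrank ℂ D = r} := by
    refine ⟨Module.finrank ℂ B, ?_⟩
    rintro _ ⟨D, _, _, rfl⟩
    exact Submodule.finrank_le (Subalgebra.toSubmodule D.toSubalgebra)
  obtain ⟨D, hED, hD, hr⟩ := Nat.sSup_mem
    (s := {r | ∃ D, E ≤ D ∧ P D ∧ Module.finrank ℂ D = r}) ⟨_, E, le_rfl, h, rfl⟩ hbdd
  refine (hmono hED).trans (finrank_le_rank_of_maximal ⟨hD, fun D' hD' hle => ?_⟩)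
  have h1 : Module.finrank ℂ D' ≤ Module.finrank ℂ D := by
    rw [hr]
    exact le_csSup hbdd ⟨D', hED.trans hle, hD', rfl⟩
  have h2 := Submodule.eq_of_le_of_finrank_le (S₁ := Subalgebra.toSubmodule D.toSubalgebra)
    (S₂ := Subalgebra.toSubmodule D'.toSubalgebra) hle h1
  intro x hx
  have : x ∈ Subalgebra.toSubmodule D'.toSubalgebra := hx
  rw [← h2] at this
  exact this

instance finiteDimensional_starSubalgebra (E : StarSubalgebra ℂ B) : FiniteDimensional ℂ E :=
  inferInstanceAs (FiniteDimensional ℂ (Subalgebra.toSubmodule E.toSubalgebra))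

theorem one_le_rank [Nontrivial B] : 1 ≤ rank B := by
  refine le_trans ?_ (finrank_le_rank (E := (⊥ : StarSubalgebra ℂ B)) ?_)
  · exact Module.finrank_pos
  · intro x hx y hy
    rw [StarSubalgebra.mem_bot] at hx hy
    obtain ⟨c, rfl⟩ := hx
    exact Algebra.commutes c y

/-- The rank of a finite power is at most the sum of the ranks of the factors: an abelian
⋆-subalgebra embeds into the product of its coordinate projections. -/
theorem rank_pi_le (ι : Type*) [Fintype ι] : rank (ι → B) ≤ Fintype.card ι * rank B := by
  refine csSup_le' ?_
  rintro _ ⟨E, hE, rfl⟩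
  let p : ι → (ι → B) →⋆ₐ[ℂ] B := fun i => Pi.evalStarAlgHom ℂ (fun _ => B) i
  have hp : ∀ i, Module.finrank ℂ (E.map (p i)) ≤ rank B := fun i => by
    refine finrank_le_rank ?_
    rintro _ ⟨x, hx, rfl⟩ _ ⟨y, hy, rfl⟩
    rw [← map_mul, ← map_mul]
    exact congrArg _ (hE.1 x hx y hy)
  let f : E →ₗ[ℂ] ((i : ι) → (E.map (p i))) :=
    { toFun := fun x i => ⟨x.1 i, ⟨x.1, x.2, rfl⟩⟩
      map_add' := fun _ _ => rfl
      map_smul' := fun _ _ => rfl }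
  have hf : Function.Injective f := fun x y hxy => by
    ext i
    exact congrArg Subtype.val (congrFun hxy i)
  calc Module.finrank ℂ E ≤ Module.finrank ℂ ((i : ι) → (E.map (p i))) :=
        LinearMap.finrank_le_finrank_of_injective hf
    _ = ∑ i, Module.finrank ℂ (E.map (p i)) := Module.finrank_pi_fintype ℂ
    _ ≤ ∑ _i : ι, rank B := Finset.sum_le_sum fun i _ => hp i
    _ = Fintype.card ι * rank B := by simp

end Rank

/-! ### Block diagonal operators and the fibrewise representation of the mapping torus -/

section BlockDiagonal

variable {X : Type*} [TopologicalSpace X] [CompactSpace X]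
  {H : Type*} [NormedAddCommGroup H] [InnerProductSpace ℂ H]

/-- The operator on `ℓ²(X, H)` whose diagonal blocks are the values of an operator valued
continuous function. -/
def blockDiagonal : C(X, H →L[ℂ] H) →ₗ[ℂ]
    (lp (fun _ : X => H) 2 →L[ℂ] lp (fun _ : X => H) 2) where
  toFun T := lp.mapCLM 2 (fun x => T x) (norm_nonneg T) T.norm_coe_le_norm
  map_add' S T := by
    ext v x
    simp
  map_smul' c T := by
    ext v x
    simp

@[simp]
theorem blockDiagonal_apply (T : C(X, H →L[ℂ] H)) (v : lp (fun _ : X => H) 2) (x : X) :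
    blockDiagonal T v x = T x (v x) := rfl

theorem hasSum_inner_blockDiagonal (T : C(X, H →L[ℂ] H)) (v w : lp (fun _ : X => H) 2) :
    HasSum (fun x => inner ℂ (v x) (T x (w x))) (inner ℂ v (blockDiagonal T w)) :=
  lp.hasSum_inner v (blockDiagonal T w)

theorem norm_blockDiagonal_le (T : C(X, H →L[ℂ] H)) {C : ℝ} (hC : 0 ≤ C) (h : ∀ x, ‖T x‖ ≤ C) :
    ‖blockDiagonal T‖ ≤ C := by
  have : blockDiagonal T = lp.mapCLM 2 (fun x => T x) hC h := by
    ext v x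
    rfl
  rw [this]
  exact lp.norm_mapCLM_le _ _ _ _

end BlockDiagonal

namespace MappingTorus

variable {A : Type*} [NonUnitalCStarAlgebra A] {α : A ≃⋆ₐ[ℂ] A}

/-- Evaluation of elements of the mapping torus at a point, a ⋆-homomorphism. -/
def evalHom (α : A ≃⋆ₐ[ℂ] A) (s : unitInterval) : MappingTorus α →⋆ₙₐ[ℂ] A where
  toFun f := f.toMap s
  map_smul' _ _ := rfl
  map_zero' := rfl
  map_add' _ _ := rfl
  map_mul' _ _ := rfl
  map_star' _ := rfl

theorem ext_toMap {f g : MappingTorus α} (h : ∀ s, f.toMap s = g.toMap s) : f = g :=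
  toMap_injective (ContinuousMap.ext h)

theorem norm_le_of_forall {f : MappingTorus α} {C : ℝ} (hC : 0 ≤ C) (h : ∀ s, ‖f.toMap s‖ ≤ C) :
    ‖f‖ ≤ C :=
  (ContinuousMap.norm_le _ hC).2 h

theorem norm_toMap_le (f : MappingTorus α) (s : unitInterval) : ‖f.toMap s‖ ≤ ‖f‖ :=
  f.toMap.norm_coe_le_norm s

variable {H : Type*} [NormedAddCommGroup H] [InnerProductSpace ℂ H] [CompleteSpace H]

/-- An element of the mapping torus as an operator valued function, through a representation. -/
def operatorMap (π : A →⋆ₙₐ[ℂ] (H →L[ℂ] H)) (f : MappingTorus α) : C(unitInterval, H →L[ℂ] H) :=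
  ⟨fun s => π (f.toMap s),
    (AddMonoidHomClass.continuous_of_bound π 1 fun x => by
      simpa using NonUnitalStarAlgHom.norm_apply_le π x).comp f.toMap.continuous⟩

@[simp]
theorem operatorMap_apply (π : A →⋆ₙₐ[ℂ] (H →L[ℂ] H)) (f : MappingTorus α) (s : unitInterval) :
    operatorMap π f s = π (f.toMap s) := rfl

/-- The representation of the mapping torus on `ℓ²([0,1], H)` that is the direct sum of all point
evaluations, composed with a representation of `A` on `H`. -/
def fibreRep (α : A ≃⋆ₐ[ℂ] A) (π : A →⋆ₙₐ[ℂ] (H →L[ℂ] H)) : MappingTorus α →⋆ₙₐ[ℂ]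
    (lp (fun _ : unitInterval => H) 2 →L[ℂ] lp (fun _ : unitInterval => H) 2) where
  toFun f := blockDiagonal (operatorMap π f)
  map_smul' c f := by
    ext v s
    change π ((evalHom α s) (c • f)) (v s) = c • π (evalHom α s f) (v s)
    simp only [map_smul, smul_apply]
  map_zero' := by
    ext v s
    change π ((evalHom α s) 0) (v s) = 0
    simp only [map_zero, zero_apply]
  map_add' f g := by
    ext v s
    change π ((evalHom α s) (f + g)) (v s) = π (evalHom α s f) (v s) + π (evalHom α s g) (v s)
    simp only [map_add, add_apply]
  map_mul' f g := by
    ext v s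
    change π ((evalHom α s) (f * g)) (v s) = π (evalHom α s f) (π (evalHom α s g) (v s))
    simp only [map_mul, mul_apply_eq_comp]
  map_star' f := by
    rw [ContinuousLinearMap.star_eq_adjoint, ContinuousLinearMap.eq_adjoint_iff]
    intro v w
    refine (lp.hasSum_inner _ _).unique ((lp.hasSum_inner _ _).congr_fun ?_)
    intro s
    change inner ℂ (π ((evalHom α s) (star f)) (v s)) (w s) =
      inner ℂ (v s) (π (evalHom α s f) (w s))
    rw [map_star, map_star, ContinuousLinearMap.star_eq_adjoint,
      ContinuousLinearMap.adjoint_inner_left]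

theorem fibreRep_apply (π : A →⋆ₙₐ[ℂ] (H →L[ℂ] H)) (f : MappingTorus α) :
    fibreRep α π f = blockDiagonal (operatorMap π f) := rfl

theorem fibreRep_injective (π : A →⋆ₙₐ[ℂ] (H →L[ℂ] H)) (hπ : Function.Injective π) :
    Function.Injective (fibreRep α π) := by
  classical
  intro f g h
  refine ext_toMap fun s => hπ (ContinuousLinearMap.ext fun x => ?_)
  have := congrArg (fun T => T (lp.single 2 s x) s) h
  simpa [fibreRep_apply] using this

end MappingTorus

/-! ### Approximations of the mapping torus by sampling finitely many fibres -/

section Sampling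

open MappingTorus

variable {A : Type*} [NonUnitalCStarAlgebra A] [PartialOrder A] [StarOrderedRing A]
  {H : Type*} [NormedAddCommGroup H] [InnerProductSpace ℂ H] [CompleteSpace H]

/-- Average the values of `ψ` on finitely many coordinates, with weights depending on the
fibre. -/
def averageMap {B : Type*} [NonUnitalCStarAlgebra B] [PartialOrder B] [StarOrderedRing B]
    {ι : Type*} [Fintype ι] (h : ι → C(unitInterval, ℝ)) (ψ : B →CP (H →L[ℂ] H)) :
    (ι → B) →ₗ[ℂ] C(unitInterval, H →L[ℂ] H) where
  toFun b := ⟨fun s => ∑ l, ((h l s : ℝ) : ℂ) • ψ (b l), by fun_prop⟩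
  map_add' a b := by
    ext s : 1
    simp [Finset.sum_add_distrib]
  map_smul' c b := by
    ext s : 1
    simp [Finset.smul_sum, smul_comm c]

@[simp]
theorem averageMap_apply {B : Type*} [NonUnitalCStarAlgebra B] [PartialOrder B]
    [StarOrderedRing B] {ι : Type*} [Fintype ι] (h : ι → C(unitInterval, ℝ))
    (ψ : B →CP (H →L[ℂ] H)) (b : ι → B) (s : unitInterval) :
    averageMap h ψ b s = ∑ l, ((h l s : ℝ) : ℂ) • ψ (b l) := rfl

theorem averageMap_kernel_nonneg {B : Type*} [NonUnitalCStarAlgebra B] [PartialOrder B]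
    [StarOrderedRing B] {ι : Type*} [Fintype ι] (h : ι → C(unitInterval, ℝ))
    (hh : ∀ l s, 0 ≤ h l s) (ψ : B →CP (H →L[ℂ] H)) {n : ℕ} (x : Fin n → ι → B)
    (ξ : Fin n → lp (fun _ : unitInterval => H) 2) :
    0 ≤ ∑ i, ∑ j, inner ℂ (ξ i) (blockDiagonal (averageMap h ψ (star (x i) * x j)) (ξ j)) := by
  have hs := hasSum_sum (s := Finset.univ) fun i _ => hasSum_sum (s := Finset.univ) fun j _ =>
    hasSum_inner_blockDiagonal (averageMap h ψ (star (x i) * x j)) (ξ i) (ξ j)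
  refine hs.nonneg fun s => ?_
  have : ∑ i, ∑ j, inner ℂ (ξ i s) (averageMap h ψ (star (x i) * x j) s (ξ j s)) =
      ∑ l, ((h l s : ℝ) : ℂ) *
        ∑ i, ∑ j, inner ℂ (ξ i s) (ψ (star (x i l) * x j l) (ξ j s)) := by
    simp only [averageMap_apply, _root_.sum_apply, smul_apply, inner_sum,
      inner_smul_right, Finset.mul_sum]
    conv_rhs => rw [Finset.sum_comm]
    exact Finset.sum_congr rfl fun i _ => Finset.sum_comm
  rw [this]
  exact Finset.sum_nonneg fun l _ => mul_nonneg (Complex.zero_le_real.2 (hh l s))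
    (cp_kernel_nonneg ψ (fun i => x i l) fun i => ξ i s)

theorem norm_weighted_sum_le {E : Type*} [NormedAddCommGroup E] [NormedSpace ℂ E] {ι : Type*}
    [Fintype ι] (w : ι → ℝ) (hw : ∀ l, 0 ≤ w l) (hw1 : ∑ l, w l = 1) (x : ι → E) {C : ℝ}
    (hx : ∀ l, w l ≠ 0 → ‖x l‖ ≤ C) : ‖∑ l, ((w l : ℝ) : ℂ) • x l‖ ≤ C := by
  calc ‖∑ l, ((w l : ℝ) : ℂ) • x l‖ ≤ ∑ l, w l * C := by
        refine norm_sum_le_of_le _ fun l _ => ?_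
        rw [norm_smul, Complex.norm_real, Real.norm_of_nonneg (hw l)]
        rcases eq_or_ne (w l) 0 with h | h
        · rw [h, zero_mul, zero_mul]
        · exact mul_le_mul_of_nonneg_left (hx l h) (hw l)
    _ = C := by rw [← Finset.sum_mul, hw1, one_mul]

/-- Sample an element of the mapping torus at finitely many points, approximate the values in `A`,
and interpolate with a partition of unity. -/
def CPA.sample (T : CPA A H) (α : A ≃⋆ₐ[ℂ] A) {ι : Type} [Fintype ι] [Nonempty ι]
    (p : ι → unitInterval) (h : ι → C(unitInterval, ℝ)) (hh : ∀ l s, 0 ≤ h l s)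
    (hh1 : ∀ s, ∑ l, h l s = 1) :
    CPA (MappingTorus α) (lp (fun _ : unitInterval => H) 2) where
  B := ι → T.B
  φ := cpPi fun l => cpComp T.φ (cpOfHom (evalHom α (p l)))
  ψ := cpOfKernel (blockDiagonal ∘ₗ averageMap h T.ψ) fun n x ξ =>
    averageMap_kernel_nonneg h hh T.ψ x ξ
  norm_φ_le f := by
    refine (pi_norm_le_iff_of_nonneg (norm_nonneg f)).2 fun l => ?_
    exact (T.norm_φ_le _).trans (norm_toMap_le f (p l))
  norm_ψ_le b := by
    refine norm_blockDiagonal_le _ (norm_nonneg b) fun s => ?_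
    exact norm_weighted_sum_le _ (fun l => hh l s) (hh1 s) _ fun l _ =>
      (T.norm_ψ_le _).trans (norm_le_pi_norm b l)

theorem CPA.norm_sample_sub_le (T : CPA A H) (π : A →⋆ₙₐ[ℂ] (H →L[ℂ] H)) (α : A ≃⋆ₐ[ℂ] A)
    {ι : Type} [Fintype ι] [Nonempty ι] (p : ι → unitInterval) (h : ι → C(unitInterval, ℝ))
    (hh : ∀ l s, 0 ≤ h l s) (hh1 : ∀ s, ∑ l, h l s = 1) (f : MappingTorus α) {ε₁ ε₂ : ℝ}
    (hε₁ : 0 ≤ ε₁) (hε₂ : 0 ≤ ε₂)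
    (h1 : ∀ l s, h l s ≠ 0 → ‖f.toMap s - f.toMap (p l)‖ ≤ ε₁)
    (h2 : ∀ l, ‖T.ψ (T.φ (f.toMap (p l))) - π (f.toMap (p l))‖ ≤ ε₂) :
    ‖(T.sample α p h hh hh1).ψ ((T.sample α p h hh hh1).φ f) - fibreRep α π f‖ ≤ ε₁ + ε₂ := by
  change ‖blockDiagonal (averageMap h T.ψ fun l => T.φ (f.toMap (p l))) -
    blockDiagonal (operatorMap π f)‖ ≤ _
  rw [← map_sub]
  refine norm_blockDiagonal_le _ (add_nonneg hε₁ hε₂) fun s => ?_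
  have : (averageMap h T.ψ (fun l => T.φ (f.toMap (p l))) - operatorMap π f) s =
      ∑ l, ((h l s : ℝ) : ℂ) • (T.ψ (T.φ (f.toMap (p l))) - π (f.toMap s)) := by
    rw [ContinuousMap.sub_apply, averageMap_apply, operatorMap_apply]
    simp only [smul_sub, Finset.sum_sub_distrib]
    rw [← Finset.sum_smul, ← Complex.ofReal_sum, hh1, Complex.ofReal_one, one_smul]
  rw [this]
  refine norm_weighted_sum_le _ (fun l => hh l s) (hh1 s) _ fun l hl => ?_
  calc ‖T.ψ (T.φ (f.toMap (p l))) - π (f.toMap s)‖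
      = ‖(T.ψ (T.φ (f.toMap (p l))) - π (f.toMap (p l))) -
          π (f.toMap s - f.toMap (p l))‖ := by
        rw [map_sub]
        congr 1
        abel
    _ ≤ ε₂ + ε₁ := (norm_sub_le _ _).trans (add_le_add (h2 l)
        ((NonUnitalStarAlgHom.norm_apply_le π _).trans (h1 l s hl)))
    _ = ε₁ + ε₂ := add_comm _ _

/-- Fine partitions of unity on `[0,1]` with a sample point for each function. -/
theorem exists_partition {η : ℝ} (hη : 0 < η) :
    ∃ (n : ℕ) (p : Fin (n + 1) → unitInterval) (h : Fin (n + 1) → C(unitInterval, ℝ)),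
      (∀ l s, 0 ≤ h l s) ∧ (∀ s, ∑ l, h l s = 1) ∧ ∀ l s, h l s ≠ 0 → dist s (p l) < η := by
  obtain ⟨t, -, ht, hcov⟩ := (isCompact_univ (X := unitInterval)).finite_cover_balls hη
  lift t to Finset unitInterval using ht
  have hne : t.card ≠ 0 := by
    intro h0
    rw [Finset.card_eq_zero] at h0
    subst h0
    simpa using hcov (Set.mem_univ (0 : unitInterval))
  obtain ⟨n, hn⟩ := Nat.exists_eq_succ_of_ne_zero hne
  let e : Fin (n + 1) ≃ t := (t.equivFinOfCardEq hn).symm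
  obtain ⟨f, hf⟩ := PartitionOfUnity.exists_isSubordinate (isClosed_univ (X := unitInterval))
    (fun l : Fin (n + 1) => Metric.ball (e l : unitInterval) η) (fun _ => Metric.isOpen_ball)
    (by
      intro x hx
      obtain ⟨y, hy, hxy⟩ := Set.mem_iUnion₂.1 (hcov hx)
      refine Set.mem_iUnion.2 ⟨e.symm ⟨y, hy⟩, ?_⟩
      rwa [Equiv.apply_symm_apply])
  refine ⟨n, fun l => e l, fun l => f l, fun l s => f.nonneg l s, fun s => ?_, fun l s hs => ?_⟩
  · rw [← finsum_eq_sum_of_fintype]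
    exact f.sum_eq_one (Set.mem_univ s)
  · exact hf l (subset_tsupport _ hs)

end Sampling

/-! ### Upper bound for the flow on the mapping torus, and exactness -/

section UpperBound

open MappingTorus

variable {A : Type*} [NonUnitalCStarAlgebra A] {α : A ≃⋆ₐ[ℂ] A}

theorem flow_pow_apply (t : ℝ) (i : ℕ) (f : MappingTorus α) :
    (flow α t ^ i : MappingTorus α ≃⋆ₐ[ℂ] MappingTorus α) f = shift (i * t) f := by
  induction i with
  | zero => simp [shift_zero]
  | succ i ih =>
    rw [pow_succ', StarAlgEquiv.mul_apply, ih]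
    change shift t (shift (i * t) f) = _
    rw [shift_shift]
    congr 1
    push_cast
    ring

theorem flow_neg (t : ℝ) : flow α (-t) = (flow α t)⁻¹ := StarAlgEquiv.ext fun _ => rfl

theorem norm_starAlgEquiv_apply (β : A ≃⋆ₐ[ℂ] A) (a : A) : ‖β a‖ = ‖a‖ :=
  NonUnitalStarAlgHom.norm_map β β.injective a

/-- The extension of an element of the mapping torus to the line is uniformly continuous: it is so
on `[-1, 2]`, and translation by integers acts by isometries. -/
theorem uniformContinuous_extend (f : MappingTorus α) : UniformContinuous f.extend := by
  rw [Metric.uniformContinuous_iff]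
  intro ε hε
  have hu := (isCompact_Icc (a := (-1 : ℝ)) (b := 2)).uniformContinuousOn_of_continuous
    f.continuous_extend.continuousOn
  rw [Metric.uniformContinuousOn_iff] at hu
  obtain ⟨η, hη, h⟩ := hu ε hε
  refine ⟨min η 1, lt_min hη one_pos, fun {x y} hxy => ?_⟩
  have h1 := hxy.trans_le (min_le_left _ _)
  have h2 := hxy.trans_le (min_le_right _ _)
  rw [Real.dist_eq, abs_lt] at h2
  have h3 := Int.floor_le x
  have h4 := Int.lt_floor_add_one x
  have key : ∀ z : ℝ, f.extend z = (α ^ ⌊x⌋ : A ≃⋆ₐ[ℂ] A) (f.extend (z - ⌊x⌋)) := fun z => by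
    rw [← extend_add_int, sub_add_cancel]
  rw [key x, key y, (StarAlgEquiv.isometry _).dist_eq]
  refine h _ ⟨by linarith, by linarith⟩ _ ⟨by linarith, by linarith⟩ ?_
  rwa [dist_sub_right]

variable [PartialOrder A] [StarOrderedRing A]
  {H : Type*} [NormedAddCommGroup H] [InnerProductSpace ℂ H] [CompleteSpace H]

/-- A good approximation on `b` is an approximation on elements near `b`. -/
theorem CPA.norm_sub_le_of_near {D : Type*} [NonUnitalCStarAlgebra D] [PartialOrder D]
    [StarOrderedRing D] (T : CPA D H) (π : D →⋆ₙₐ[ℂ] (H →L[ℂ] H)) (a b : D) :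
    ‖T.ψ (T.φ a) - π a‖ ≤ 2 * ‖a - b‖ + ‖T.ψ (T.φ b) - π b‖ := by
  calc ‖T.ψ (T.φ a) - π a‖
      = ‖T.ψ (T.φ (a - b)) - π (a - b) + (T.ψ (T.φ b) - π b)‖ := by
        simp only [map_sub]
        congr 1
        abel
    _ ≤ ‖T.ψ (T.φ (a - b))‖ + ‖π (a - b)‖ + ‖T.ψ (T.φ b) - π b‖ :=
        (norm_add_le _ _).trans (add_le_add_left (norm_sub_le _ _) _)
    _ ≤ ‖a - b‖ + ‖a - b‖ + ‖T.ψ (T.φ b) - π b‖ := by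
        gcongr
        · exact (T.norm_ψ_le _).trans (T.norm_φ_le _)
        · exact NonUnitalStarAlgHom.norm_apply_le π _
    _ = _ := by ring

/-- An approximation of `A` on about `m t` iterates of a finite set gives, by sampling at finitely
many points independent of `m`, an approximation of the mapping torus on `m` iterates of the flow
at time `t`. -/
theorem exists_sample_approximates (π : A →⋆ₙₐ[ℂ] (H →L[ℂ] H)) (α : A ≃⋆ₐ[ℂ] A)
    (ω : Finset (MappingTorus α)) {δ : ℝ} (hδ : 0 < δ) {t : ℝ} (ht : 0 ≤ t) :
    ∃ (N : ℕ) (ω' : Finset A) (δ' : ℝ), 0 < δ' ∧ ∀ (m : ℕ) (T : CPA A H),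
      T.Approximates π (⋃ k ∈ Set.Iio (⌊m * t⌋₊ + 2), (α ^ k : A ≃⋆ₐ[ℂ] A) '' (ω' : Set A)) δ' →
      ∃ T' : CPA (MappingTorus α) (lp (fun _ : unitInterval => H) 2), rank T'.B ≤ N * rank T.B ∧
        T'.Approximates (fibreRep α π) (⋃ i ∈ Set.Iio m,
          (flow α t ^ i : MappingTorus α ≃⋆ₐ[ℂ] MappingTorus α) ''
            (ω : Set (MappingTorus α))) δ := by
  classical
  set ε := δ / 8 with hε
  have hε0 : 0 < ε := by positivity
  obtain ⟨η, hη, hmod⟩ : ∃ η > 0, ∀ f ∈ ω, ∀ x y : ℝ, dist x y < η →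
      ‖f.extend x - f.extend y‖ < ε := by
    choose! η hη hη' using fun f : MappingTorus α =>
      Metric.uniformContinuous_iff.1 (uniformContinuous_extend f) ε hε0
    rcases ω.eq_empty_or_nonempty with rfl | hne
    · exact ⟨1, one_pos, by simp⟩
    · refine ⟨ω.inf' hne η, (Finset.lt_inf'_iff _).2 fun f _ => hη f, fun f hf x y hxy => ?_⟩
      rw [← dist_eq_norm]
      exact hη' f (hxy.trans_le (Finset.inf'_le _ hf))
  obtain ⟨n, p, h, hh, hh1, hp⟩ := exists_partition hη
  -- The values at the sample points form an `ε`-net in the values of the elements of `ω`.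
  refine ⟨n + 1,
    (ω ×ˢ Finset.univ).image (fun q : MappingTorus α × Fin (n + 1) => q.1.toMap (p q.2)), ε, hε0, fun m T hT => ⟨T.sample α p h hh hh1, ?_, ?_⟩⟩
  · exact (rank_pi_le (B := T.B) (Fin (n + 1))).trans_eq (by rw [Fintype.card_fin])
  intro x hx
  simp only [Set.mem_iUnion, Set.mem_Iio] at hx
  obtain ⟨i, hi, f, hf, rfl⟩ := hx
  rw [flow_pow_apply]
  have hval : ∀ s : unitInterval, (shift (i * t) f).toMap s = f.extend (s + i * t) := fun _ => rfl
  refine (T.norm_sample_sub_le π α p h hh hh1 _ hε0.le (by positivity : 0 ≤ 2 * ε + ε)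
    ?_ ?_).trans_lt (by linarith)
  · intro l s hl
    rw [hval, hval]
    refine (hmod f hf _ _ ?_).le
    rw [dist_add_right]
    exact hp l s hl
  · intro l
    set r : unitInterval := ⟨Int.fract ((p l : ℝ) + i * t), unitInterval.fract_mem _⟩
    have hpos : (0 : ℝ) ≤ (p l : ℝ) + i * t := add_nonneg (p l).2.1 (by positivity)
    obtain ⟨k', hk'⟩ := Int.eq_ofNat_of_zero_le (Int.floor_nonneg.2 hpos)
    obtain ⟨j, hj⟩ : ∃ j, h j r ≠ 0 := by
      by_contra hcon
      push Not at hcon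
      have := hh1 r
      simp [hcon] at this
    have hnear : ‖f.toMap r - f.toMap (p j)‖ < ε := by
      rw [← extend_coe, ← extend_coe]
      exact hmod f hf _ _ (hp j r hj)
    have hx : (shift (i * t) f).toMap (p l) = (α ^ k' : A ≃⋆ₐ[ℂ] A) (f.toMap r) := by
      rw [shift_apply, hk', zpow_natCast]
    rw [hx]
    refine (T.norm_sub_le_of_near π _ ((α ^ k' : A ≃⋆ₐ[ℂ] A) (f.toMap (p j)))).trans ?_
    refine add_le_add ?_ (hT _ ?_).le
    · rw [← map_sub, norm_starAlgEquiv_apply]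
      linarith
    · simp only [Set.mem_iUnion, Set.mem_Iio]
      refine ⟨k', ?_, f.toMap (p j), ?_, rfl⟩
      · have h1 : (k' : ℝ) ≤ (p l : ℝ) + i * t := by
          have := Int.floor_le ((p l : ℝ) + i * t)
          rw [hk'] at this
          exact_mod_cast this
        have h2 : (p l : ℝ) ≤ 1 := (p l).2.2
        have h3 : (i : ℝ) * t ≤ m * t := by gcongr
        have h4 : (k' : ℝ) < ((⌊m * t⌋₊ + 2 : ℕ) : ℝ) := by
          have := Nat.lt_floor_add_one (m * t)
          push_cast
          linarith
        exact_mod_cast h4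
      · simp only [Finset.coe_image, Set.mem_image]
        exact ⟨(f, j), by simpa using hf, rfl⟩

/-- The infimum defining the completely positive rank is attained when it is finite. -/
theorem exists_rank_le_rcp {D : Type*} [NonUnitalCStarAlgebra D] [PartialOrder D]
    [StarOrderedRing D] {π : D →⋆ₙₐ[ℂ] (H →L[ℂ] H)} {ω : Set D} {δ : ℝ} (h : rcp π ω δ ≠ ⊤) :
    ∃ T : CPA D H, T.Approximates π ω δ ∧ (rank T.B : ℕ∞) ≤ rcp π ω δ := by
  obtain ⟨r, hr⟩ := ENat.ne_top_iff_exists.1 h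
  have hlt : rcp π ω δ < (r : ℕ∞) + 1 := by
    rw [← hr]
    exact_mod_cast Nat.lt_succ_self r
  simp only [rcp, iInf_lt_iff] at hlt
  obtain ⟨T, hT, hTr⟩ := hlt
  refine ⟨T, hT, ?_⟩
  rw [← hr]
  have : rank T.B < r + 1 := by exact_mod_cast hTr
  exact_mod_cast Nat.lt_succ_iff.1 this

/-- The upper bound for completely positive ranks along the flow; the factor `N` is the number of
sampled fibres. -/
theorem rcp_flow_le (π : A →⋆ₙₐ[ℂ] (H →L[ℂ] H)) (α : A ≃⋆ₐ[ℂ] A)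
    (ω : Finset (MappingTorus α)) {δ : ℝ} (hδ : 0 < δ) {t : ℝ} (ht : 0 ≤ t) :
    ∃ (N : ℕ) (ω' : Finset A) (δ' : ℝ), 0 < N ∧ 0 < δ' ∧ ∀ m : ℕ,
      rcp (fibreRep α π) (⋃ i ∈ Set.Iio m,
        (flow α t ^ i : MappingTorus α ≃⋆ₐ[ℂ] MappingTorus α) '' (ω : Set (MappingTorus α))) δ ≤
      N * rcp π (⋃ k ∈ Set.Iio (⌊m * t⌋₊ + 2), (α ^ k : A ≃⋆ₐ[ℂ] A) '' (ω' : Set A)) δ' := by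
  obtain ⟨N, ω', δ', hδ', h⟩ := exists_sample_approximates π α ω hδ ht
  refine ⟨N + 1, ω', δ', N.succ_pos, hδ', fun m => ?_⟩
  rcases eq_or_ne (rcp π (⋃ k ∈ Set.Iio (⌊m * t⌋₊ + 2),
    (α ^ k : A ≃⋆ₐ[ℂ] A) '' (ω' : Set A)) δ') ⊤ with htop | htop
  · rw [htop, ENat.mul_top (by simp)]
    exact le_top
  obtain ⟨T, hT, hr⟩ := exists_rank_le_rcp htop
  obtain ⟨T', hr', hT'⟩ := h m T hT
  refine (rcp_le_of_approximates T' _ hT').trans ?_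
  calc (rank T'.B : ℕ∞) ≤ ((N * rank T.B : ℕ) : ℕ∞) := by exact_mod_cast hr'
    _ ≤ (N + 1 : ℕ) * (rank T.B : ℕ∞) := by
      rw [← Nat.cast_mul]
      exact_mod_cast Nat.mul_le_mul_right _ (Nat.le_succ N)
    _ ≤ _ := by gcongr

end UpperBound

section Exactness

variable {A : Type u} [NonUnitalCStarAlgebra A] [PartialOrder A] [StarOrderedRing A]

theorem IsExact.mappingTorus (hA : IsExact A) (α : A ≃⋆ₐ[ℂ] A) : IsExact (MappingTorus α) := by
  obtain ⟨H, _, _, _, π, hπ, h⟩ := hA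
  refine ⟨lp (fun _ : unitInterval => H) 2, inferInstance, inferInstance, inferInstance,
    MappingTorus.fibreRep α π, MappingTorus.fibreRep_injective π hπ, fun ω δ hδ => ?_⟩
  obtain ⟨N, ω', δ', hδ', hT⟩ := exists_sample_approximates π α ω hδ le_rfl
  obtain ⟨T, hTa⟩ := h (finite_orbit α ω' 2).toFinset δ' hδ'
  obtain ⟨T', -, hT'⟩ := hT 1 T (by simpa using hTa)
  refine ⟨T', fun x hx => hT' x ?_⟩
  simp only [Set.mem_iUnion, Set.mem_Iio]
  exact ⟨0, one_pos, x, hx, by simp⟩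

theorem rcp_ne_top (hA : IsExact A) {K : Type*} [NormedAddCommGroup K] [InnerProductSpace ℂ K]
    [CompleteSpace K] (ρ : A →⋆ₙₐ[ℂ] (K →L[ℂ] K)) {ω : Set A} (hω : ω.Finite)
    {δ : ℝ} (hδ : 0 < δ) : rcp ρ ω δ ≠ ⊤ := by
  obtain ⟨H, _, _, _, π, hπ, h⟩ := hA
  obtain ⟨T, hT⟩ := h hω.toFinset δ hδ
  obtain ⟨T', hT', -⟩ := T.exists_approximates π hπ ρ hω hδ (by simpa using hT)
  exact ((rcp_le_of_approximates T' ρ hT').trans_lt (ENat.natCast_lt_top _)).ne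

end Exactness

theorem one_le_rcp {A : Type*} [NonUnitalCStarAlgebra A] [PartialOrder A] [StarOrderedRing A]
    {H : Type*} [NormedAddCommGroup H] [InnerProductSpace ℂ H] [CompleteSpace H]
    (π : A →⋆ₙₐ[ℂ] (H →L[ℂ] H)) (ω : Set A) (δ : ℝ) : 1 ≤ rcp π ω δ :=
  le_iInf₂ fun T _ => by exact_mod_cast one_le_rank (B := T.B)

/-! ### Lower bound for the flow on the mapping torus -/

section LowerBound

open MappingTorus

variable {A : Type*} [NonUnitalCStarAlgebra A]

/-- The elements `s ↦ w(s) a` of the mapping torus, for a function `w` vanishing at `0` and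
`1`. -/
def scale (α : A ≃⋆ₐ[ℂ] A) (w : C(unitInterval, ℝ)) (h0 : w 0 = 0) (h1 : w 1 = 0) :
    A →ₗ[ℂ] MappingTorus α where
  toFun a := ⟨⟨fun s => ((w s : ℝ) : ℂ) • a, by fun_prop⟩, by
    rw [mem_mappingTorus]
    simp [h0, h1]⟩
  map_add' a b := ext_toMap fun s => smul_add ((w s : ℝ) : ℂ) a b
  map_smul' c a := ext_toMap fun s => smul_comm ((w s : ℝ) : ℂ) c a

variable {α : A ≃⋆ₐ[ℂ] A}

theorem scale_star_mul (w : C(unitInterval, ℝ)) (h0 : w 0 = 0) (h1 : w 1 = 0)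
    (hw : ∀ s, 0 ≤ w s) (a b : A) :
    scale α w h0 h1 (star a * b) =
      star (scale α (⟨fun s => √(w s), by fun_prop⟩) (by simp [h0]) (by simp [h1]) a) *
        scale α (⟨fun s => √(w s), by fun_prop⟩) (by simp [h0]) (by simp [h1]) b := by
  refine ext_toMap fun s => ?_
  change ((w s : ℝ) : ℂ) • (star a * b) = star (((√(w s) : ℝ) : ℂ) • a) * (((√(w s) : ℝ) : ℂ) • b)
  rw [star_smul, smul_mul_smul_comm, RCLike.star_def, Complex.conj_ofReal, ← Complex.ofReal_mul,
    Real.mul_self_sqrt (hw s)]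

variable [PartialOrder A] [StarOrderedRing A]

theorem scale_nonneg (w : C(unitInterval, ℝ)) (h0 : w 0 = 0) (h1 : w 1 = 0)
    (hw : ∀ s, 0 ≤ w s) {a : A} (ha : 0 ≤ a) : 0 ≤ scale α w h0 h1 a := by
  obtain ⟨b, rfl⟩ := exists_eq_star_mul_self ha
  rw [scale_star_mul w h0 h1 hw]
  exact star_mul_self_nonneg _

theorem scale_mono {w w' : C(unitInterval, ℝ)} (h0 : w 0 = 0) (h1 : w 1 = 0)
    (h0' : w' 0 = 0) (h1' : w' 1 = 0) (hw : ∀ s, w s ≤ w' s) {a : A} (ha : 0 ≤ a) :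
    scale α w h0 h1 a ≤ scale α w' h0' h1' a := by
  rw [← sub_nonneg]
  have : scale α w' h0' h1' a - scale α w h0 h1 a =
      scale α (w' - w) (by simp [h0, h0']) (by simp [h1, h1']) a := by
    refine ext_toMap fun s => ?_
    change ((w' s : ℝ) : ℂ) • a - ((w s : ℝ) : ℂ) • a = (((w' s - w s : ℝ)) : ℂ) • a
    rw [Complex.ofReal_sub, sub_smul]
  rw [this]
  exact scale_nonneg _ _ _ (fun s => sub_nonneg.2 (hw s)) ha

/-- The tent function of height `c` and slope `4`, with its peak at `1/2 - v`. -/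
def tent (c v : ℝ) : C(unitInterval, ℝ) :=
  ⟨fun s => max 0 (c - 4 * |(s : ℝ) + v - 1 / 2|), by fun_prop⟩

theorem tent_apply (c v : ℝ) (s : unitInterval) :
    tent c v s = max 0 (c - 4 * |(s : ℝ) + v - 1 / 2|) := rfl

theorem tent_nonneg (c v : ℝ) (s : unitInterval) : 0 ≤ tent c v s := le_max_left _ _

theorem tent_zero {c v : ℝ} (hc : c ≤ 3 / 2) (hv : |v| ≤ 1 / 8) : tent c v 0 = 0 := by
  have := abs_le.1 hv
  rw [tent_apply, max_eq_left]
  have : -(0 + v - 1 / 2) ≤ |(0 : ℝ) + v - 1 / 2| := neg_le_abs _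
  simp only [Set.Icc.coe_zero]
  linarith

theorem tent_one {c v : ℝ} (hc : c ≤ 3 / 2) (hv : |v| ≤ 1 / 8) : tent c v 1 = 0 := by
  have := abs_le.1 hv
  rw [tent_apply, max_eq_left]
  have : 1 + v - 1 / 2 ≤ |(1 : ℝ) + v - 1 / 2| := le_abs_self _
  simp only [Set.Icc.coe_one]
  linarith

theorem tent_le_tent {c c' v v' : ℝ} (h : c + 4 * |v - v'| ≤ c') (s : unitInterval) :
    tent c v s ≤ tent c' v' s := by
  rw [tent_apply, tent_apply]
  refine max_le_max le_rfl ?_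
  have : |(s : ℝ) + v' - 1 / 2| ≤ |(s : ℝ) + v - 1 / 2| + |v - v'| := by
    rw [abs_sub_comm v v']
    refine (abs_add_le _ _).trans_eq' ?_
    congr 1
    ring
  linarith

/-- The element `s ↦ tent(s) a` of the mapping torus. -/
def tentElement (α : A ≃⋆ₐ[ℂ] A) {c v : ℝ} (hc : c ≤ 3 / 2) (hv : |v| ≤ 1 / 8) :
    A →ₗ[ℂ] MappingTorus α :=
  scale α (tent c v) (tent_zero hc hv) (tent_one hc hv)

theorem abs_zero_le_eighth : |(0 : ℝ)| ≤ 1 / 8 := by norm_num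

/-- Under the flow for a time close to an integer `k`, a tent element moves to the tent element of
`α ^ k (a)` with a slightly moved peak. -/
theorem shift_tentElement {c v : ℝ} (hc : c ≤ 3 / 2) (hv : |v| ≤ 1 / 8) (k : ℕ) (a : A) :
    shift (k + v) (tentElement α hc abs_zero_le_eighth a) =
      tentElement α hc hv ((α ^ k : A ≃⋆ₐ[ℂ] A) a) := by
  have hv' := abs_le.1 hv
  refine ext_toMap fun s => ?_
  set f := tentElement α hc abs_zero_le_eighth a with hf
  have hs0 : (0 : ℝ) ≤ s := s.2.1
  have hs1 : (s : ℝ) ≤ 1 := s.2.2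
  have hk : (shift (k + v) f).toMap s = (α ^ (k : ℤ) : A ≃⋆ₐ[ℂ] A) (f.extend (s + v)) := by
    rw [← extend_add_int]
    change f.extend (s + (k + v)) = _
    congr 1
    push_cast
    ring
  have hmap : ∀ r : unitInterval, f.toMap r = ((tent c 0 r : ℝ) : ℂ) • a := fun _ => rfl
  have hgoal : f.extend (s + v) = ((tent c v s : ℝ) : ℂ) • a := by
    rcases lt_or_ge ((s : ℝ) + v) 0 with h | h
    · have hmem : (s : ℝ) + v - ((-1 : ℤ) : ℝ) ∈ unitInterval := by
        push_cast
        constructor <;> linarith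
      rw [f.extend_of_mem (-1) hmem, hmap]
      have h1 : tent c 0 ⟨(s : ℝ) + v - ((-1 : ℤ) : ℝ), hmem⟩ = 0 := by
        rw [tent_apply, max_eq_left]
        have := le_abs_self ((s : ℝ) + v - ((-1 : ℤ) : ℝ) + 0 - 1 / 2)
        push_cast at this ⊢
        linarith
      have h2 : tent c v s = 0 := by
        rw [tent_apply, max_eq_left]
        have := neg_le_abs ((s : ℝ) + v - 1 / 2)
        linarith
      rw [h1, h2]
      simp
    · rcases le_or_gt ((s : ℝ) + v) 1 with h' | h'
      · have hmem : (s : ℝ) + v - ((0 : ℤ) : ℝ) ∈ unitInterval := by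
          push_cast
          constructor <;> linarith
        rw [f.extend_of_mem 0 hmem, hmap]
        have h1 : tent c 0 ⟨(s : ℝ) + v - ((0 : ℤ) : ℝ), hmem⟩ = tent c v s := by
          simp [tent_apply]
        rw [h1]
        simp
      · have hmem : (s : ℝ) + v - ((1 : ℤ) : ℝ) ∈ unitInterval := by
          push_cast
          constructor <;> linarith
        rw [f.extend_of_mem 1 hmem, hmap]
        have h1 : tent c 0 ⟨(s : ℝ) + v - ((1 : ℤ) : ℝ), hmem⟩ = 0 := by
          rw [tent_apply, max_eq_left]
          have := neg_le_abs ((s : ℝ) + v - ((1 : ℤ) : ℝ) + 0 - 1 / 2)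
          push_cast at this ⊢
          linarith
        have h2 : tent c v s = 0 := by
          rw [tent_apply, max_eq_left]
          have := le_abs_self ((s : ℝ) + v - 1 / 2)
          linarith
        rw [h1, h2]
        simp
  rw [hk, hgoal, zpow_natCast, map_smul]
  rfl

variable {H : Type*} [NormedAddCommGroup H] [InnerProductSpace ℂ H] [CompleteSpace H]

/-- The midpoint of the unit interval. -/
def midpoint : unitInterval := ⟨1 / 2, by constructor <;> norm_num⟩

/-- The inclusion of the fibre over the midpoint. -/
def fibreInclusion (H : Type*) [NormedAddCommGroup H] [InnerProductSpace ℂ H] :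
    H →L[ℂ] lp (fun _ : unitInterval => H) 2 :=
  by classical exact lp.singleContinuousLinearMap ℂ (fun _ => H) 2 midpoint

omit [CompleteSpace H] in
theorem norm_fibreInclusion_apply (ξ : H) : ‖fibreInclusion H ξ‖ = ‖ξ‖ := by
  classical
  simp [fibreInclusion]

omit [PartialOrder A] [StarOrderedRing A] in
theorem inner_fibreRep (π : A →⋆ₙₐ[ℂ] (H →L[ℂ] H)) (f : MappingTorus α) (ξ η : H) :
    inner ℂ (fibreInclusion H ξ) (fibreRep α π f (fibreInclusion H η)) =
      inner ℂ ξ (π (f.toMap midpoint) η) := by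
  classical
  simp [fibreInclusion, fibreRep_apply, lp.inner_single_left]

/-- An approximation of the mapping torus restricts to one of `A`, by multiplication with a
tent function and compression to the fibre over the midpoint. -/
def CPA.localize (T : CPA (MappingTorus α) (lp (fun _ : unitInterval => H) 2)) : CPA A H where
  B := T.B
  φ := cpComp T.φ (cpOfFactor (tentElement α (c := 1) (by norm_num) abs_zero_le_eighth) _
    (scale_star_mul (tent 1 0) _ _ (tent_nonneg 1 0)))
  ψ := cpOfKernel (conjSum (fun _ : Fin 1 => fibreInclusion H) T.ψ) fun _ x ξ =>
    conjSum_kernel_nonneg _ T.ψ x ξ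
  norm_φ_le a := by
    refine (T.norm_φ_le _).trans (norm_le_of_forall (norm_nonneg a) fun s => ?_)
    change ‖((tent 1 0 s : ℝ) : ℂ) • a‖ ≤ ‖a‖
    rw [norm_smul, Complex.norm_real, Real.norm_of_nonneg (tent_nonneg _ _ _)]
    refine mul_le_of_le_one_left (norm_nonneg a) ?_
    rw [tent_apply]
    refine max_le zero_le_one ?_
    have := abs_nonneg ((s : ℝ) + 0 - 1 / 2)
    linarith
  norm_ψ_le b := by
    refine norm_le_of_inner_le _ (norm_nonneg b) fun ξ η => ?_
    rw [cpOfKernel_apply, inner_conjSum]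
    refine (norm_sum_inner_le _ (fun ξ => by simp [norm_fibreInclusion_apply]) _ ξ η).trans ?_
    gcongr
    exact T.norm_ψ_le b

/-- The compression of an operator on `ℓ²([0,1], H)` to the fibre over the midpoint. -/
def fibreCompress (H : Type*) [NormedAddCommGroup H] [InnerProductSpace ℂ H] [CompleteSpace H] :
    (lp (fun _ : unitInterval => H) 2 →L[ℂ] lp (fun _ : unitInterval => H) 2) →ₗ[ℂ]
      (H →L[ℂ] H) where
  toFun S := (fibreInclusion H).adjoint ∘L S ∘L fibreInclusion H
  map_add' S S' := by simp [ContinuousLinearMap.comp_add, ContinuousLinearMap.add_comp]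
  map_smul' c S := by simp

theorem inner_fibreCompress
    (S : lp (fun _ : unitInterval => H) 2 →L[ℂ] lp (fun _ : unitInterval => H) 2) (ξ η : H) :
    inner ℂ ξ (fibreCompress H S η) = inner ℂ (fibreInclusion H ξ) (S (fibreInclusion H η)) := by
  change inner ℂ ξ ((fibreInclusion H).adjoint (S (fibreInclusion H η))) = _
  rw [ContinuousLinearMap.adjoint_inner_right]

theorem norm_fibreCompress_le
    (S : lp (fun _ : unitInterval => H) 2 →L[ℂ] lp (fun _ : unitInterval => H) 2) :
    ‖fibreCompress H S‖ ≤ ‖S‖ := by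
  refine norm_le_of_inner_le _ (norm_nonneg S) fun ξ η => ?_
  rw [inner_fibreCompress]
  refine (norm_inner_le_norm _ _).trans ?_
  have := S.le_opNorm (fibreInclusion H η)
  rw [norm_fibreInclusion_apply] at this ⊢
  calc ‖ξ‖ * ‖S (fibreInclusion H η)‖ ≤ ‖ξ‖ * (‖S‖ * ‖η‖) := by gcongr
    _ = _ := by ring

theorem fibreCompress_mono
    {S S' : lp (fun _ : unitInterval => H) 2 →L[ℂ] lp (fun _ : unitInterval => H) 2} (h : S ≤ S') :
    fibreCompress H S ≤ fibreCompress H S' := by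
  rw [← sub_nonneg] at h ⊢
  rw [← map_sub, operator_nonneg_iff]
  intro ξ
  rw [inner_fibreCompress]
  exact (operator_nonneg_iff _).1 h _

omit [PartialOrder A] [StarOrderedRing A] in
theorem fibreCompress_fibreRep (π : A →⋆ₙₐ[ℂ] (H →L[ℂ] H)) (f : MappingTorus α) :
    fibreCompress H (fibreRep α π f) = π (f.toMap midpoint) :=
  ContinuousLinearMap.ext fun η => ext_inner_left ℂ fun ξ => by
    rw [inner_fibreCompress, inner_fibreRep]

theorem CPA.localize_apply (T : CPA (MappingTorus α) (lp (fun _ : unitInterval => H) 2)) (a : A) :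
    T.localize.ψ (T.localize.φ a) = fibreCompress H (T.ψ (T.φ
      (tentElement α (c := 1) (by norm_num) abs_zero_le_eighth a))) :=
  ContinuousLinearMap.ext fun η => ext_inner_left ℂ fun ξ => by
    rw [inner_fibreCompress]
    refine (inner_conjSum (fun _ : Fin 1 => fibreInclusion H) T.ψ (T.φ
      (tentElement α (c := 1) (by norm_num) abs_zero_le_eighth a)) ξ η).trans ?_
    rw [Fin.sum_univ_one]

theorem norm_sub_le_of_between {P Q P' R : H →L[ℂ] H} (h : P ≤ Q) (h' : Q ≤ P') {r : ℝ}
    (hP : ‖P - R‖ ≤ r) (hP' : ‖P' - R‖ ≤ r) : ‖Q - R‖ ≤ 3 * r := by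
  have h1 : ‖Q - P‖ ≤ ‖P' - P‖ :=
    CStarAlgebra.norm_le_norm_of_nonneg_of_le (sub_nonneg.2 h) (sub_le_sub_right h' P)
  have h2 : ‖P' - P‖ ≤ r + r := by
    rw [← sub_sub_sub_cancel_right P' P R]
    exact (norm_sub_le _ _).trans (add_le_add hP' hP)
  calc ‖Q - R‖ = ‖(Q - P) + (P - R)‖ := by rw [sub_add_sub_cancel]
    _ ≤ ‖Q - P‖ + ‖P - R‖ := norm_add_le _ _
    _ ≤ 3 * r := by linarith

/-- If an approximation of the mapping torus is good on two tent elements that lie slightly below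
and slightly above the tent element of `b`, then its localization is good on `b`, by
positivity. -/
theorem CPA.norm_localize_sub_le (T : CPA (MappingTorus α) (lp (fun _ : unitInterval => H) 2))
    (π : A →⋆ₙₐ[ℂ] (H →L[ℂ] H)) {b : A} (hb : 0 ≤ b) {ε v δ : ℝ} (hε0 : 0 ≤ ε) (hε : ε ≤ 1 / 2)
    (hv : 4 * |v| ≤ ε) (hc : 1 - ε ≤ 3 / 2) (hc' : 1 + ε ≤ 3 / 2) (hv' : |v| ≤ 1 / 8)
    (h : ‖T.ψ (T.φ (tentElement α hc hv' b)) - fibreRep α π (tentElement α hc hv' b)‖ ≤ δ)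
    (h' : ‖T.ψ (T.φ (tentElement α hc' hv' b)) - fibreRep α π (tentElement α hc' hv' b)‖ ≤ δ) :
    ‖T.localize.ψ (T.localize.φ b) - π b‖ ≤ 3 * (δ + 2 * ε * ‖b‖) := by
  have hmono : ∀ x y : MappingTorus α, x ≤ y →
      fibreCompress H (T.ψ (T.φ x)) ≤ fibreCompress H (T.ψ (T.φ y)) := fun x y hxy =>
    fibreCompress_mono (OrderHomClass.mono T.ψ (OrderHomClass.mono T.φ hxy))
  have key : ∀ (c : ℝ) (hc : c ≤ 3 / 2), |tent c v midpoint - 1| ≤ 2 * ε →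
      ‖T.ψ (T.φ (tentElement α hc hv' b)) - fibreRep α π (tentElement α hc hv' b)‖ ≤ δ →
      ‖fibreCompress H (T.ψ (T.φ (tentElement α hc hv' b))) - π b‖ ≤ δ + 2 * ε * ‖b‖ := by
    intro c hc hct hT
    have h1 := (norm_fibreCompress_le _).trans hT
    rw [map_sub, fibreCompress_fibreRep] at h1
    have h2 : ‖π ((tentElement α hc hv' b).toMap midpoint) - π b‖ ≤ 2 * ε * ‖b‖ := by
      rw [← map_sub]
      refine (NonUnitalStarAlgHom.norm_apply_le π _).trans ?_
      have : (tentElement α hc hv' b).toMap midpoint - b =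
          ((tent c v midpoint - 1 : ℝ) : ℂ) • b := by
        rw [Complex.ofReal_sub, sub_smul, Complex.ofReal_one, one_smul]
        rfl
      rw [this, norm_smul, Complex.norm_real]
      gcongr
      exact hct
    refine le_trans (le_of_eq ?_) ((norm_add_le _ _).trans (add_le_add h1 h2))
    rw [sub_add_sub_cancel]
  have habs : |((midpoint : unitInterval) : ℝ) + v - 1 / 2| = |v| := by
    congr 1
    simp [midpoint]
  rw [T.localize_apply]
  refine norm_sub_le_of_between (hmono (tentElement α hc hv' b) _ ?_)
    (hmono _ (tentElement α hc' hv' b) ?_) (key _ hc ?_ h) (key _ hc' ?_ h')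
  · refine scale_mono _ _ _ _ (tent_le_tent ?_) hb
    rw [sub_zero]
    linarith
  · refine scale_mono _ _ _ _ (tent_le_tent ?_) hb
    rw [zero_sub, abs_neg]
    linarith
  · rw [tent_apply, habs, max_eq_right (by linarith), abs_le]
    constructor <;> linarith [abs_nonneg v]
  · rw [tent_apply, habs, max_eq_right (by linarith), abs_le]
    constructor <;> linarith [abs_nonneg v]

/-- For every integer `k < m t` one of finitely many fixed times brings an orbit
time `i t`, `i < m`, close to `k`. -/
theorem exists_time_near {t ε : ℝ} (ht : 0 < t) (hε : 0 < ε) {m k : ℕ} (hk : (k : ℝ) < m * t) :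
    ∃ i < m, ∃ l < ⌊t / ε⌋₊ + 1, ∃ v : ℝ, |v| ≤ ε ∧ (i : ℝ) * t + l * ε = k + v := by
  set i := ⌊(k : ℝ) / t⌋₊
  have h1 : (i : ℝ) * t ≤ k := (le_div_iff₀ ht).1 (Nat.floor_le (by positivity))
  have h2 : (k : ℝ) < (i + 1) * t := (div_lt_iff₀ ht).1 (Nat.lt_floor_add_one _)
  set l := ⌊(k - i * t) / ε⌋₊
  have h0 : 0 ≤ (k - i * t) / ε := div_nonneg (by linarith) hε.le
  have h3 : (l : ℝ) * ε ≤ k - i * t := (le_div_iff₀ hε).1 (Nat.floor_le h0)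
  have h4 : k - i * t < (l + 1) * ε := (div_lt_iff₀ hε).1 (Nat.lt_floor_add_one _)
  refine ⟨i, ?_, l, ?_, i * t + l * ε - k, ?_, by ring⟩
  · rw [Nat.floor_lt (by positivity), div_lt_iff₀ ht]
    exact hk
  · refine Nat.lt_succ_of_le (Nat.floor_le_floor ?_)
    gcongr
    linarith
  · rw [abs_le]
    constructor <;> linarith

/-- The lower bound for completely positive ranks along the flow: localize an approximation of the
mapping torus that is good on finitely many translates of tent elements. -/
theorem exists_rcp_le_flow (π : A →⋆ₙₐ[ℂ] (H →L[ℂ] H)) (α : A ≃⋆ₐ[ℂ] A)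
    (ω : Finset A) {δ : ℝ} (hδ : 0 < δ) {t : ℝ} (ht : 0 < t) :
    ∃ (ω' : Finset (MappingTorus α)) (δ' : ℝ), 0 < δ' ∧ ∀ m n : ℕ, (n : ℝ) ≤ m * t →
      rcp π (⋃ k ∈ Set.Iio n, (α ^ k : A ≃⋆ₐ[ℂ] A) '' (ω : Set A)) δ ≤
      rcp (fibreRep α π) (⋃ i ∈ Set.Iio m,
        (flow α t ^ i : MappingTorus α ≃⋆ₐ[ℂ] MappingTorus α) ''
          (ω' : Set (MappingTorus α))) δ' := by
  classical
  -- Decompose the elements of `ω` into positive ones.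
  choose x hx0 hxn hx using fun a : A => CStarAlgebra.exists_sum_four_nonneg a
  obtain ⟨M, hM0, hM⟩ : ∃ M : ℝ, 0 ≤ M ∧ ∀ a ∈ ω, ‖a‖ ≤ M :=
    ⟨∑ a ∈ ω, ‖a‖, by positivity, fun a ha =>
      Finset.single_le_sum (f := fun a => ‖a‖) (fun _ _ => norm_nonneg _) ha⟩
  obtain ⟨ε, hε0, hε1, hεM⟩ : ∃ ε : ℝ, 0 < ε ∧ ε ≤ 1 / 2 ∧ 2 * ε * M ≤ δ / 48 := by
    refine ⟨min (1 / 2) (δ / 48 / (2 * M + 1)), lt_min (by norm_num) (by positivity),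
      min_le_left _ _, ?_⟩
    have h1 : min (1 / 2) (δ / 48 / (2 * M + 1)) * (2 * M + 1) ≤ δ / 48 := by
      rw [← le_div_iff₀ (by positivity)]
      exact min_le_right _ _
    have h2 : 0 < min (1 / 2) (δ / 48 / (2 * M + 1)) := lt_min (by norm_num) (by positivity)
    nlinarith
  have hc : 1 - ε ≤ 3 / 2 := by linarith
  have hc' : 1 + ε ≤ 3 / 2 := by linarith
  let g : ℕ × A × Fin 4 → MappingTorus α := fun q =>
    shift (q.1 * (ε / 4)) (tentElement α hc abs_zero_le_eighth (x q.2.1 q.2.2))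
  let g' : ℕ × A × Fin 4 → MappingTorus α := fun q =>
    shift (q.1 * (ε / 4)) (tentElement α hc' abs_zero_le_eighth (x q.2.1 q.2.2))
  let P : Finset (ℕ × A × Fin 4) := Finset.range (⌊t / (ε / 4)⌋₊ + 1) ×ˢ ω ×ˢ Finset.univ
  refine ⟨P.image g ∪ P.image g', δ / 48, by positivity, fun m n hmn => ?_⟩
  refine le_iInf₂ fun T hT => ?_
  refine rcp_le_of_approximates T.localize π ?_
  intro y hy
  simp only [Set.mem_iUnion, Set.mem_Iio] at hy
  obtain ⟨k, hk, a, ha, rfl⟩ := hy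
  have ha' : a ∈ ω := ha
  obtain ⟨i, hi, l, hl, v, hv, hiv⟩ := exists_time_near ht (by positivity : 0 < ε / 4)
    (show (k : ℝ) < m * t from lt_of_lt_of_le (by exact_mod_cast hk) hmn)
  have hv' : |v| ≤ 1 / 8 := by linarith
  have hpos : ∀ j, ‖T.localize.ψ (T.localize.φ ((α ^ k : A ≃⋆ₐ[ℂ] A) (x a j))) -
      π ((α ^ k : A ≃⋆ₐ[ℂ] A) (x a j))‖ ≤ δ / 8 := by
    intro j
    have hb : 0 ≤ (α ^ k : A ≃⋆ₐ[ℂ] A) (x a j) :=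
      map_nonneg_of_nonneg ((α ^ k : A ≃⋆ₐ[ℂ] A) : A →⋆ₙₐ[ℂ] A) (hx0 a j)
    have hP : (l, a, j) ∈ P := by
      simp only [P, Finset.mem_product, Finset.mem_range, Finset.mem_univ, and_true]
      exact ⟨hl, ha'⟩
    have hmem : ∀ f : MappingTorus α, f ∈ P.image g ∪ P.image g' →
        shift (i * t) f ∈ ⋃ i ∈ Set.Iio m,
          (flow α t ^ i : MappingTorus α ≃⋆ₐ[ℂ] MappingTorus α) ''
            ((P.image g ∪ P.image g' : Finset (MappingTorus α)) : Set (MappingTorus α)) :=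
      fun f hf => by
        simp only [Set.mem_iUnion, Set.mem_Iio]
        exact ⟨i, hi, f, hf, flow_pow_apply t i f⟩
    have e1 := hT _ (hmem (g (l, a, j)) (Finset.mem_union_left _ (Finset.mem_image_of_mem g hP)))
    have e2 := hT _ (hmem (g' (l, a, j)) (Finset.mem_union_right _ (Finset.mem_image_of_mem g' hP)))
    simp only [g, g', shift_shift, hiv, shift_tentElement _ hv'] at e1 e2
    refine (T.norm_localize_sub_le π hb hε0.le hε1 (by linarith) hc hc' hv' e1.le e2.le).trans ?_
    have hn : ‖(α ^ k : A ≃⋆ₐ[ℂ] A) (x a j)‖ ≤ M := by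
      rw [norm_starAlgEquiv_apply]
      exact (hxn a j).trans (hM a ha')
    have : 2 * ε * ‖(α ^ k : A ≃⋆ₐ[ℂ] A) (x a j)‖ ≤ 2 * ε * M := by gcongr
    linarith
  have hsum : (α ^ k : A ≃⋆ₐ[ℂ] A) a =
      ∑ j : Fin 4, Complex.I ^ (j : ℕ) • (α ^ k : A ≃⋆ₐ[ℂ] A) (x a j) := by
    conv_lhs => rw [hx a]
    rw [map_sum]
    exact Finset.sum_congr rfl fun j _ => map_smul _ _ _
  rw [hsum]
  simp only [map_sum, map_smul, ← Finset.sum_sub_distrib, ← smul_sub]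
  calc _ ≤ ∑ _j : Fin 4, δ / 8 := norm_sum_le_of_le _ fun j _ => by
        rw [norm_smul, norm_pow, Complex.norm_I, one_pow, one_mul]
        exact hpos j
    _ = δ / 2 := by
        rw [Finset.sum_const, Finset.card_univ, Fintype.card_fin]
        ring
    _ < δ := by linarith

end LowerBound

/-! ### Growth rates and the entropy of the flow -/

/-- Comparison of exponential growth rates under a change of time `k m ∼ t m`. -/
theorem limsup_div_le {u v : ℕ → EReal} {k : ℕ → ℕ} {c t : ℝ} (ht : 0 < t)
    (hkt : Tendsto (fun m : ℕ => (k m : ℝ) / m) atTop (𝓝 t))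
    (huv : ∀ m, v m ≤ c + u (k m)) :
    limsup (fun m : ℕ => v m / (m : EReal)) atTop ≤
      (t : EReal) * limsup (fun n : ℕ => u n / (n : EReal)) atTop := by
  have hk : Tendsto k atTop atTop := by
    rw [← tendsto_natCast_atTop_iff (R := ℝ)]
    have := hkt.pos_mul_atTop ht (tendsto_natCast_atTop_atTop (R := ℝ))
    refine this.congr' ?_
    filter_upwards [eventually_gt_atTop 0] with m hm
    have : (m : ℝ) ≠ 0 := by positivity
    field_simp
  set h := limsup (fun n : ℕ => u n / (n : EReal)) atTop
  have ht' : (0 : EReal) < t := by exact_mod_cast ht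
  refine le_of_forall_gt_imp_ge_of_dense fun z hz => ?_
  rw [mul_comm, ← EReal.lt_div_iff ht' (EReal.coe_ne_top t),
    EReal.lt_iff_exists_real_btwn] at hz
  obtain ⟨r, hr, hrz⟩ := hz
  rw [EReal.lt_div_iff ht' (EReal.coe_ne_top t)] at hrz
  refine le_trans ?_ hrz.le
  have hu := hk.eventually (eventually_lt_of_limsup_lt hr)
  have hlim : Tendsto (fun m : ℕ => (((c + r * k m) / m : ℝ) : EReal)) atTop
      (𝓝 ((r * t : ℝ) : EReal)) := by
    refine (continuous_coe_real_ereal.tendsto _).comp ?_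
    have h1 := (tendsto_const_div_atTop_nhds_zero_nat c).add (hkt.const_mul r)
    rw [zero_add] at h1
    refine h1.congr fun m => ?_
    ring
  rw [← EReal.coe_mul, ← hlim.limsup_eq]
  refine limsup_le_limsup ?_
  filter_upwards [hu, hk.eventually (eventually_gt_atTop 0), eventually_gt_atTop 0] with m h1 h2 h3
  have h2' : (0 : EReal) < (k m : EReal) := by exact_mod_cast h2
  have h3' : (0 : EReal) < (m : EReal) := by exact_mod_cast h3
  rw [EReal.div_lt_iff h2' (EReal.natCast_ne_top _)] at h1
  have hv : v m ≤ ((c + r * k m : ℝ) : EReal) := by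
    refine (huv m).trans ?_
    rw [EReal.coe_add, EReal.coe_mul]
    gcongr
    exact h1.le
  rw [EReal.coe_div]
  exact EReal.div_le_div_right_of_nonneg h3'.le hv

section Flow

variable {A : Type*} [NonUnitalCStarAlgebra A] [PartialOrder A] [StarOrderedRing A]
  {H : Type*} [NormedAddCommGroup H] [InnerProductSpace ℂ H] [CompleteSpace H]

theorem htAt_le_ht (π : A →⋆ₙₐ[ℂ] (H →L[ℂ] H)) (α : A ≃⋆ₐ[ℂ] A) (ω : Finset A) {δ : ℝ}
    (hδ : 0 < δ) : htAt π α (ω : Set A) δ ≤ ht π α :=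
  le_iSup_of_le ω (le_iSup₂_of_le δ hδ le_rfl)

theorem ht_flow_le (π : A →⋆ₙₐ[ℂ] (H →L[ℂ] H)) (α : A ≃⋆ₐ[ℂ] A) {t : ℝ} (ht₀ : 0 < t) :
    ht (MappingTorus.fibreRep α π) (flow α t) ≤ (t : EReal) * ht π α := by
  refine iSup_le fun ω => iSup₂_le fun δ hδ => ?_
  obtain ⟨N, ω', δ', hN, hδ', h⟩ := rcp_flow_le π α ω hδ ht₀.le
  have ht' : (0 : EReal) ≤ t := by exact_mod_cast ht₀.le
  refine le_trans ?_ (mul_le_mul_of_nonneg_left (htAt_le_ht π α ω' hδ') ht')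
  refine limsup_div_le (k := fun m => ⌊m * t⌋₊ + 2) (c := Real.log N) ht₀ ?_ fun m => ?_
  · have h1 := ((tendsto_nat_floor_mul_div_atTop ht₀.le).comp
      (tendsto_natCast_atTop_atTop (R := ℝ))).add (tendsto_const_div_atTop_nhds_zero_nat (2 : ℝ))
    rw [add_zero] at h1
    refine h1.congr fun m => ?_
    simp only [Function.comp_apply]
    rw [mul_comm t]
    push_cast
    ring
  · have hlog : ((Real.log N : ℝ) : EReal) = ENNReal.log (N : ENNReal) := by
      rw [← ENNReal.ofReal_natCast, ENNReal.log_ofReal_of_pos (by exact_mod_cast hN)]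
    rw [hlog, ← ENNReal.log_mul_add]
    refine ENNReal.log_monotone ?_
    have := ENat.toENNReal_mono (h m)
    rwa [ENat.toENNReal_mul, ENat.toENNReal_coe] at this

theorem le_ht_flow (π : A →⋆ₙₐ[ℂ] (H →L[ℂ] H)) (α : A ≃⋆ₐ[ℂ] A) {t : ℝ} (ht₀ : 0 < t) :
    (t : EReal) * ht π α ≤ ht (MappingTorus.fibreRep α π) (flow α t) := by
  have ht' : (0 : EReal) ≤ t := by exact_mod_cast ht₀.le
  have hti : (0 : EReal) ≤ (t⁻¹ : ℝ) := by exact_mod_cast (inv_pos.2 ht₀).le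
  have key : ht π α ≤ ((t⁻¹ : ℝ) : EReal) * ht (MappingTorus.fibreRep α π) (flow α t) := by
    refine iSup_le fun ω => iSup₂_le fun δ hδ => ?_
    obtain ⟨ω', δ', hδ', h⟩ := exists_rcp_le_flow π α ω hδ ht₀
    refine le_trans ?_ (mul_le_mul_of_nonneg_left
      (htAt_le_ht (MappingTorus.fibreRep α π) (flow α t) ω' hδ') hti)
    refine limsup_div_le (k := fun n => ⌈t⁻¹ * n⌉₊) (c := 0) (inv_pos.2 ht₀)
      ((tendsto_nat_ceil_mul_div_atTop (inv_pos.2 ht₀).le).comp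
        (tendsto_natCast_atTop_atTop (R := ℝ))) fun n => ?_
    rw [EReal.coe_zero, zero_add]
    refine ENNReal.log_monotone (ENat.toENNReal_mono (h _ n ?_))
    have := Nat.le_ceil (t⁻¹ * (n : ℝ))
    rwa [inv_mul_le_iff₀ ht₀, mul_comm t] at this
  calc (t : EReal) * ht π α
      ≤ t * (((t⁻¹ : ℝ) : EReal) * ht (MappingTorus.fibreRep α π) (flow α t)) :=
        mul_le_mul_of_nonneg_left key ht'
    _ = _ := by
        rw [← mul_assoc, ← EReal.coe_mul, mul_inv_cancel₀ ht₀.ne', EReal.coe_one, one_mul]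

/-- On an exact C⋆-algebra the identity has entropy zero, since every finite set has finite
completely positive rank. -/
theorem ht_one (hA : IsExact A) (π : A →⋆ₙₐ[ℂ] (H →L[ℂ] H)) : ht π 1 = 0 := by
  have key : ∀ (ω : Finset A) (δ : ℝ), 0 < δ → htAt π 1 (ω : Set A) δ = 0 := by
    intro ω δ hδ
    have hfin := rcp_ne_top hA π ω.finite_toSet hδ
    obtain ⟨r, hr⟩ := ENat.ne_top_iff_exists.1 hfin
    have hr1 : 0 < r := by
      have := one_le_rcp π (ω : Set A) δ
      rw [← hr] at this
      exact_mod_cast this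
    have hlim : Tendsto (fun m : ℕ => ((Real.log r / m : ℝ) : EReal)) atTop (𝓝 ((0 : ℝ) : EReal)) :=
      (continuous_coe_real_ereal.tendsto _).comp (tendsto_const_div_atTop_nhds_zero_nat _)
    rw [← EReal.coe_zero, ← hlim.limsup_eq]
    refine limsup_congr ?_
    filter_upwards [eventually_gt_atTop 0] with m hm
    have horb : (⋃ i ∈ Set.Iio m, ((1 : A ≃⋆ₐ[ℂ] A) ^ i : A ≃⋆ₐ[ℂ] A) '' (ω : Set A)) = ω := by
      ext x
      simp only [one_pow, Set.mem_iUnion]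
      constructor
      · rintro ⟨i, _, y, hy, rfl⟩
        exact hy
      · exact fun hx => ⟨0, hm, x, hx, rfl⟩
    rw [horb, ← hr, EReal.coe_div, ENat.toENNReal_coe, ← ENNReal.ofReal_natCast,
      ENNReal.log_ofReal_of_pos (by exact_mod_cast hr1)]
    rfl
  refine le_antisymm (iSup_le fun ω => iSup₂_le fun δ hδ => (key ω δ hδ).le) ?_
  rw [← key ∅ 1 one_pos]
  exact htAt_le_ht π 1 ∅ one_pos

omit [PartialOrder A] [StarOrderedRing A] in
theorem flow_zero (α : A ≃⋆ₐ[ℂ] A) : flow α 0 = 1 :=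
  StarAlgEquiv.ext fun f => MappingTorus.shift_zero f

end Flow

end VoiculescuBrown

end

theorem theorem2p4 {A : Type*} [NonUnitalCStarAlgebra A] [PartialOrder A] [StarOrderedRing A]
    (hA : VoiculescuBrown.IsExact A) (α : A ≃⋆ₐ[ℂ] A) :
    VoiculescuBrown.IsExact (VoiculescuBrown.MappingTorus α) ∧
      ∀ {H : Type*} [NormedAddCommGroup H] [InnerProductSpace ℂ H] [CompleteSpace H]
        (π : A →⋆ₙₐ[ℂ] (H →L[ℂ] H)) (_ : Function.Injective π)
        {K : Type*} [NormedAddCommGroup K] [InnerProductSpace ℂ K] [CompleteSpace K]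
        (ρ : VoiculescuBrown.MappingTorus α →⋆ₙₐ[ℂ] (K →L[ℂ] K)) (_ : Function.Injective ρ)
        (t : ℝ),
        VoiculescuBrown.ht ρ (VoiculescuBrown.flow α t) =
          ((|t| : ℝ) : EReal) * VoiculescuBrown.ht π α := by
  refine ⟨hA.mappingTorus α, ?_⟩
  intro H _ _ _ π hπ K _ _ _ ρ hρ t
  have hpos : ∀ s : ℝ, 0 < s → VoiculescuBrown.ht ρ (VoiculescuBrown.flow α s) =
      (s : EReal) * VoiculescuBrown.ht π α := fun s hs => by
    rw [VoiculescuBrown.ht_eq_ht ρ hρ (VoiculescuBrown.MappingTorus.fibreRep α π)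
      (VoiculescuBrown.MappingTorus.fibreRep_injective π hπ)]
    exact le_antisymm (VoiculescuBrown.ht_flow_le π α hs) (VoiculescuBrown.le_ht_flow π α hs)
  rcases lt_trichotomy t 0 with h | rfl | h
  · rw [abs_of_neg h, ← hpos (-t) (neg_pos.2 h), VoiculescuBrown.flow_neg,
      VoiculescuBrown.ht_inv ρ hρ]
  · rw [VoiculescuBrown.flow_zero, VoiculescuBrown.ht_one (hA.mappingTorus α) ρ, abs_zero,
      EReal.coe_zero, zero_mul]
  · rw [abs_of_pos h, hpos t h]
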